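/- Let $R$ be a (not necessarily commutative) ring with Jacobson radical $J$ such that $R/J$ is finite and $J$ is finitely generated as a left ideal. Let $M$ be a finitely generated projective left $R$-module. Suppose that there is a two-sided ideal $I\subseteq J$ of $R$ that is invertible (that is, $I\otimes_R-$ is an auto-equivalence of the category of left $R$-modules) and such that the finite colength submodules of $M/IM$ are all isomorphic. Let $\mathcal S$ be the (finite) set of isomorphism classes of simple left $R$-modules, and write out Artin–Wedderburn decompositions $$R/J\simeq\prod_{i\in\mathcal S} \mathrm{M}_{r_i}(\mathbb F_{q_i}),\qquad M/JM\simeq\bigoplus_{i\in\mathcal S}\left(\mathbb F_{q_i}^{\oplus r_i}\right)^{\oplus m_i}.$$ Suppose that $q_i=q$, $r_i=r$ and $m_i=m$ for all $i\in\mathcal S$; that is, the simple components of $R/J$ are all isomorphic to $\mathrm M_r(\mathbb F_q)$, and every simple left $R$-module occurs in $M/JM$ with the same multiplicity $m$. Then, for each positive integer $n$, $M$ has only finitely many submodules of index $n$, say $a_{M,n}$ of them, and the Solomon zeta function $\zeta(M;s)=\sum_{n\ge1}a_{M,n}n^{-s}$ is given by $$\zeta(M;s)=\prod_{n=0}^\infty\prod_{j=0}^{m-1}\left(1-q^{\,j+mn-r(n+1)s}\right)^{-|\mathcal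 S|}.$$ In particular (Lustig's formula), if $R$ is a commutative two-dimensional regular local ring with finite residue field $\mathbb F_q$, then $R$ has only finitely many ideals of each finite index, and $$\zeta({}_RR;s)=\prod_{n=0}^\infty\left(1-q^{\,n-(n+1)s}\right)^{-1}.$$ Both identities are identities of formal Dirichlet series, $q^{a-bs}$ standing for $q^a\cdot(q^b)^{-s}$; the infinite products converge in the sense that each coefficient of the partial products is eventually constant. -/

import Mathlib

open scoped TensorProduct

universe u v w

/-! ### Tensoring with a two-sided ideal -/

section IdealTensor

variable {R : Type u} [Ring R] (I : Ideal R) [I.IsTwoSided]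

/-- The right multiplication of `R` on a two-sided ideal `I`: the element `x * a` of `I`. -/
def Ideal.rightMul (x : I) (a : R) : I :=
  ⟨(x : R) * a, I.mul_mem_right a x.2⟩

/-- The balancing relations `(x * a) ⊗ n = x ⊗ (a • n)` inside `I ⊗[ℤ] N`. Their `R`-span is their
additive span, because the set of relations is stable under left multiplication by `R`. -/
def Ideal.tensorRel (N : Type u) [AddCommGroup N] [Module R N] : Submodule R (I ⊗[ℤ] N) :=
  Submodule.span R {t | ∃ (x : I) (a : R) (n : N), t = (I.rightMul x a) ⊗ₜ[ℤ] n - x ⊗ₜ[ℤ] (a • n)}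

/-- The left `R`-module `I ⊗_R N`, for a two-sided ideal `I` and a left `R`-module `N`. -/
abbrev Ideal.tensorObj (N : Type u) [AddCommGroup N] [Module R N] : Type u :=
  (I ⊗[ℤ] N) ⧸ I.tensorRel N

theorem Ideal.tensorRel_le_comap {N N' : Type u} [AddCommGroup N] [Module R N]
    [AddCommGroup N'] [Module R N'] (f : N →ₗ[R] N') :
    I.tensorRel N ≤ (I.tensorRel N').comap
      (TensorProduct.AlgebraTensorModule.map (LinearMap.id : I →ₗ[R] I)
        f.toAddMonoidHom.toIntLinearMap) := by
  refine Submodule.span_le.2 ?_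
  rintro _ ⟨x, a, n, rfl⟩
  refine Submodule.subset_span ⟨x, a, f n, ?_⟩
  simp

/-- The map `I ⊗_R f`. -/
def Ideal.tensorMap {N N' : Type u} [AddCommGroup N] [Module R N]
    [AddCommGroup N'] [Module R N'] (f : N →ₗ[R] N') : I.tensorObj N →ₗ[R] I.tensorObj N' :=
  Submodule.mapQ _ _ (TensorProduct.AlgebraTensorModule.map (LinearMap.id : I →ₗ[R] I)
    f.toAddMonoidHom.toIntLinearMap) (I.tensorRel_le_comap f)

theorem Ideal.tensorMap_id (N : Type u) [AddCommGroup N] [Module R N] :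
    I.tensorMap (LinearMap.id : N →ₗ[R] N) = LinearMap.id := by
  refine LinearMap.ext fun x => ?_
  obtain ⟨t, rfl⟩ := Submodule.Quotient.mk_surjective _ x
  induction t using TensorProduct.induction_on with
  | zero => simp
  | tmul a b => simp [Ideal.tensorMap]
  | add a b ha hb => rw [Submodule.Quotient.mk_add, map_add, ha, hb, map_add]

theorem Ideal.tensorMap_comp {N N' N'' : Type u} [AddCommGroup N] [Module R N]
    [AddCommGroup N'] [Module R N'] [AddCommGroup N''] [Module R N'']
    (f : N →ₗ[R] N') (g : N' →ₗ[R] N'') :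
    I.tensorMap (g ∘ₗ f) = I.tensorMap g ∘ₗ I.tensorMap f := by
  refine LinearMap.ext fun x => ?_
  obtain ⟨t, rfl⟩ := Submodule.Quotient.mk_surjective _ x
  induction t using TensorProduct.induction_on with
  | zero => simp
  | tmul a b => simp [Ideal.tensorMap]
  | add a b ha hb => rw [Submodule.Quotient.mk_add, map_add, ha, hb, map_add]

/-- The functor `I ⊗_R -` on the category of left `R`-modules. -/
def Ideal.tensorFunctor : CategoryTheory.Functor (ModuleCat.{u} R) (ModuleCat.{u} R) where
  obj N := ModuleCat.of R (I.tensorObj N)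
  map f := ModuleCat.ofHom (I.tensorMap f.hom)
  map_id N := by
    apply ModuleCat.hom_ext
    exact I.tensorMap_id N
  map_comp f g := by
    apply ModuleCat.hom_ext
    exact I.tensorMap_comp f.hom g.hom

/-- A two-sided ideal `I` of `R` is invertible if `I ⊗_R -` is an auto-equivalence of the category
of left `R`-modules. -/
def Ideal.IsInvertible : Prop :=
  I.tensorFunctor.IsEquivalence

end IdealTensor

/-! ### Isomorphism classes of simple modules -/

/-- Isomorphism of simple left `R`-modules. -/
def simpleModuleSetoid (R : Type u) [Ring R] :
    Setoid {S : ModuleCat.{u} R // IsSimpleModule R S} where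
  r S T := Nonempty (S.1 ≃ₗ[R] T.1)
  iseqv :=
    ⟨fun _ => ⟨LinearEquiv.refl _ _⟩, fun ⟨e⟩ => ⟨e.symm⟩, fun ⟨e⟩ ⟨f⟩ => ⟨e.trans f⟩⟩

/-- The collection of isomorphism classes of simple left `R`-modules. -/
def SimpleModuleClass (R : Type u) [Ring R] : Type (u + 1) :=
  Quotient (simpleModuleSetoid R)

/-! ### Formal Dirichlet series

The algebra of formal Dirichlet series `∑ a n * n ^ (-s)` with complex coefficients is
`ArithmeticFunction ℂ`, with Dirichlet convolution as multiplication. -/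

/-- The formal Dirichlet series `c * a ^ (-s)`, for an integer `a ≥ 1`. -/
def dirichletMonomial (c : ℂ) (a : ℕ) : ArithmeticFunction ℂ :=
  ⟨fun n => if n = a ∧ n ≠ 0 then c else 0, by simp⟩

/-- The infinite product `∏_{n ≥ 0} F n` of formal Dirichlet series converges to `f`, for the
nonarchimedean valuation on formal Dirichlet series: for every `N`, the partial products eventually
agree with `f` in all the coefficients of index at most `N`. -/
def HasFormalProd (F : ℕ → ArithmeticFunction ℂ) (f : ArithmeticFunction ℂ) : Prop :=
  ∀ N : ℕ, ∃ K : ℕ, ∀ k ≥ K, ∀ n ≤ N, (∏ i ∈ Finset.range k, F i) n = f n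

/-- For every `n ≥ 1`, the module `M` has only finitely many submodules of index `n`. -/
def FinitelyManyOfIndex (R : Type u) (M : Type v) [Ring R] [AddCommGroup M] [Module R M] : Prop :=
  ∀ n : ℕ, 0 < n → {X : Submodule R M | Nat.card (M ⧸ X) = n}.Finite

/-- The Solomon zeta function of `M`: the formal Dirichlet series whose `n`-th coefficient is the
number of submodules of `M` of index `n`. -/
noncomputable def solomonZeta (R : Type u) (M : Type v) [Ring R] [AddCommGroup M] [Module R M] :
    ArithmeticFunction ℂ :=
  ⟨fun n => if n = 0 then 0 else (({X : Submodule R M | Nat.card (M ⧸ X) = n}.ncard : ℕ) : ℂ),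
    by simp⟩

/-! Put `Q = q ^ r`, `w = q ^ m` and `K = IM`. Every simple module has `Q` elements and receives `w`
homomorphisms from `M`. A submodule `X` of finite index determines its image `L` in `M / K` and the
submodule `X'` with `IX' = X ∩ K`, which exists and is unique because `I` is invertible
(`exists_smul_eq`, `le_of_smul_le`). Multiplication by `I` preserves indices (`relIndex_smul`), so
`[M : X] = [M : X'] [M / K : L]`; moreover `X ≤ X'`, so `L` lies in the image of `X'`. Conversely,
fix `X'` and such an `L`. Since `L ≃ M / K`, the possible `X` correspond to the lifts to `X' / IX'`
of a surjection `M → L` with kernel `K`. As `M` is projective, these form a torsor under `Hom(M, (X'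
∩ K) / IX')`, which has `w ^ l'` elements if the image of `X'` has index `Q ^ l'` (`card_fiber`).

Let `b k l` count the `X` of index `Q ^ k` whose image has index `Q ^ l`, and let `c i` count the
submodules of `M / K` of index `Q ^ i`. The image of `X'` is itself isomorphic to `M / K`, so it
contains `c (l - l')` choices of `L`. Hence `b (k + l) l = ∑ c i * w ^ j * b k j` over `i + j = l`
(`bigradedCount_add`). With `C(t) = ∑ c i t ^ i` and `B_n(t) = ∑ w ^ (n l) b k l t ^ (n l + k)` this
reads `B_n(t) = C(w ^ n t ^ (n + 1)) B_{n+1}(t)`. Now `B_0` is the zeta function at `t = Q ^ (-s)`,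
and `B_n` tends to `1` because only `X = M` maps onto `M / K`. So the zeta function is `∏ C(w ^ n t
^ (n + 1))` (`hasFormalProd_of_recursion`).

To find `C`, let `N = M / K` and consider the series counting submodules that map onto a semisimple
quotient `D` of `N`. Replacing `D` by `D × V` with `V` simple multiplies it by `1 - |Hom(D, V)| t`,
because the submodules lost lie in the kernels of maps `N → V`, and these kernels are copies of `N`
of index `Q` (`surjSeries_prod`). Building up from `D = 0` to the top of `N`, where only `N` itself
is counted, gives `C(t) ∏ (1 - q ^ j t) ^ |S| = 1` (`mk_card_submodules_mul`).

For a two-dimensional regular local ring take `I = (y)` with `y` part of a system of parameters: `R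
/ (y)` is a discrete valuation ring, so its nonzero ideals are all isomorphic to it. -/

/-! ### Power series and formal Dirichlet series -/

/-- The ring homomorphism from power series to formal Dirichlet series that sends the variable
to `a ^ (-s)`. -/
noncomputable def PowerSeries.toDirichlet (a : ℕ) (ha : 1 < a) :
    PowerSeries ℂ →+* ArithmeticFunction ℂ where
  toFun f := ⟨fun n => if a ^ Nat.log a n = n then PowerSeries.coeff (Nat.log a n) f else 0, by simp⟩
  map_one' := by
    ext n
    change (if a ^ Nat.log a n = n then PowerSeries.coeff (Nat.log a n) (1 : PowerSeries ℂ) else 0)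
      = if n = 1 then 1 else 0
    rw [PowerSeries.coeff_one]
    by_cases hn : n = 1
    · simp [hn]
    · rw [if_neg hn, ite_eq_right_iff]
      intro h
      rw [if_neg]
      intro h0
      rw [h0] at h
      exact hn (by simpa using h.symm)
  map_zero' := by
    ext n
    change (if a ^ Nat.log a n = n then PowerSeries.coeff (Nat.log a n) (0 : PowerSeries ℂ) else 0)
      = 0
    simp
  map_add' f g := by
    ext n
    change (if a ^ Nat.log a n = n then PowerSeries.coeff (Nat.log a n) (f + g) else 0) =
      (if a ^ Nat.log a n = n then PowerSeries.coeff (Nat.log a n) f else 0) +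
      (if a ^ Nat.log a n = n then PowerSeries.coeff (Nat.log a n) g else 0)
    split_ifs <;> simp
  map_mul' f g := by
    ext n
    change (if a ^ Nat.log a n = n then PowerSeries.coeff (Nat.log a n) (f * g) else 0) =
      ∑ x ∈ n.divisorsAntidiagonal,
        (if a ^ Nat.log a x.1 = x.1 then PowerSeries.coeff (Nat.log a x.1) f else 0) *
        (if a ^ Nat.log a x.2 = x.2 then PowerSeries.coeff (Nat.log a x.2) g else 0)
    by_cases h : a ^ Nat.log a n = n
    · rw [if_pos h, PowerSeries.coeff_mul]
      have hn0 : n ≠ 0 := by rw [← h]; positivity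
      -- Pairs of exponents adding up to `log n` embed into the factorizations of `n`; the
      -- factorizations not reached involve a factor that is no power of `a` and contribute zero.
      refine Finset.sum_of_injOn (fun p : ℕ × ℕ => (a ^ p.1, a ^ p.2)) ?_ ?_ ?_ ?_
      · rintro ⟨x, y⟩ - ⟨x', y'⟩ - hp
        simp only [Prod.mk.injEq] at hp
        rw [Nat.pow_right_injective ha hp.1, Nat.pow_right_injective ha hp.2]
      · rintro ⟨x, y⟩ hp
        simp only [Finset.mem_coe, Finset.HasAntidiagonal.mem_antidiagonal] at hp
        simp [← pow_add, hp, h, hn0]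
      · rintro ⟨x, y⟩ hp hp'
        simp only [Nat.mem_divisorsAntidiagonal] at hp
        by_cases h1 : a ^ Nat.log a x = x
        · by_cases h2 : a ^ Nat.log a y = y
          · exfalso
            apply hp'
            refine ⟨(Nat.log a x, Nat.log a y), ?_, by simp [h1, h2]⟩
            simp only [Finset.mem_coe, Finset.HasAntidiagonal.mem_antidiagonal]
            apply Nat.pow_right_injective ha
            simp only [pow_add, h1, h2, h, hp.1]
          · simp [h2]
        · simp [h1]
      · rintro ⟨x, y⟩ _
        simp [Nat.log_pow ha]
    · rw [if_neg h]
      symm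
      apply Finset.sum_eq_zero
      rintro ⟨x, y⟩ hp
      simp only [Nat.mem_divisorsAntidiagonal] at hp
      by_cases h1 : a ^ Nat.log a x = x
      · by_cases h2 : a ^ Nat.log a y = y
        · exfalso
          apply h
          rw [← hp.1, ← h1, ← h2, ← pow_add, Nat.log_pow ha]
        · simp [h2]
      · simp [h1]

theorem PowerSeries.toDirichlet_apply (a : ℕ) (ha : 1 < a) (f : PowerSeries ℂ) (n : ℕ) :
    PowerSeries.toDirichlet a ha f n =
      if a ^ Nat.log a n = n then PowerSeries.coeff (Nat.log a n) f else 0 := rfl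

theorem PowerSeries.toDirichlet_C_mul_X_pow (a : ℕ) (ha : 1 < a) (z : ℂ) (k : ℕ) :
    PowerSeries.toDirichlet a ha (PowerSeries.C z * PowerSeries.X ^ k) =
      dirichletMonomial z (a ^ k) := by
  ext n
  rw [PowerSeries.toDirichlet_apply, PowerSeries.coeff_C_mul_X_pow]
  change _ = if n = a ^ k ∧ n ≠ 0 then z else 0
  have h0 : a ^ k ≠ 0 := by positivity
  by_cases hn : n = a ^ k
  · rw [hn, Nat.log_pow ha, if_pos rfl, if_pos rfl, if_pos ⟨rfl, h0⟩]
  · rw [if_neg (fun h : n = a ^ k ∧ n ≠ 0 => hn h.1), ite_eq_right_iff]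
    intro h
    rw [if_neg]
    rintro rfl
    exact hn h.symm

/-- The ring homomorphism `f(t) ↦ f(z * t ^ (n + 1))` on power series. -/
noncomputable def PowerSeries.substMonomial (z : ℂ) (n : ℕ) : PowerSeries ℂ →+* PowerSeries ℂ :=
  (PowerSeries.expand (n + 1) n.succ_ne_zero).toRingHom.comp (PowerSeries.rescale z)

theorem PowerSeries.coeff_substMonomial (z : ℂ) (n : ℕ) (f : PowerSeries ℂ) (k : ℕ) :
    PowerSeries.coeff k (PowerSeries.substMonomial z n f) =
      if (n + 1) ∣ k then z ^ (k / (n + 1)) * PowerSeries.coeff (k / (n + 1)) f else 0 := by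
  simp [PowerSeries.substMonomial, PowerSeries.coeff_expand, PowerSeries.coeff_rescale]

theorem PowerSeries.coeff_substMonomial_mul (z : ℂ) (n : ℕ) (f g : PowerSeries ℂ) (k : ℕ) :
    PowerSeries.coeff k (PowerSeries.substMonomial z n f * g) =
      ∑ j ∈ (Finset.range (k + 1)).filter (fun j => (n + 1) * j ≤ k),
        z ^ j * PowerSeries.coeff j f * PowerSeries.coeff (k - (n + 1) * j) g := by
  rw [PowerSeries.coeff_mul]
  symm
  refine Finset.sum_of_injOn (fun j => ((n + 1) * j, k - (n + 1) * j)) ?_ ?_ ?_ ?_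
  · intro i _ j _ h
    simp only [Prod.mk.injEq] at h
    exact Nat.eq_of_mul_eq_mul_left n.succ_pos h.1
  · intro j hj
    simp only [Finset.mem_coe, Finset.mem_filter] at hj
    simp only [Finset.mem_coe, Finset.HasAntidiagonal.mem_antidiagonal]
    omega
  · rintro ⟨x, y⟩ hp hp'
    simp only [Finset.HasAntidiagonal.mem_antidiagonal] at hp
    rw [PowerSeries.coeff_substMonomial]
    split_ifs with h
    · exfalso
      obtain ⟨j, rfl⟩ := h
      refine hp' ⟨j, ?_, ?_⟩
      · simp only [Finset.mem_coe, Finset.mem_filter, Finset.mem_range]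
        have : j ≤ (n + 1) * j := Nat.le_mul_of_pos_left _ n.succ_pos
        omega
      · simp only [Prod.mk.injEq, true_and]; omega
    · simp
  · intro j _
    simp [PowerSeries.coeff_substMonomial, Nat.mul_div_cancel_left j n.succ_pos]

theorem PowerSeries.substMonomial_one_sub (z : ℂ) (n : ℕ) (c : ℂ) :
    PowerSeries.substMonomial z n (1 - PowerSeries.C c * PowerSeries.X) =
      1 - PowerSeries.C (c * z) * PowerSeries.X ^ (n + 1) := by
  have h : PowerSeries.rescale z (PowerSeries.C c) = PowerSeries.C c := by
    ext k
    rw [PowerSeries.coeff_rescale, PowerSeries.coeff_C]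
    split_ifs with hk <;> simp [hk]
  have h' : PowerSeries.rescale z (1 - PowerSeries.C c * PowerSeries.X) =
      1 - PowerSeries.C (c * z) * PowerSeries.X := by
    simp only [map_sub, map_one, map_mul, h, PowerSeries.rescale_X, mul_assoc]
  change PowerSeries.expand (n + 1) n.succ_ne_zero
    (PowerSeries.rescale z (1 - PowerSeries.C c * PowerSeries.X)) = _
  rw [h', map_sub, map_one, map_mul, PowerSeries.expand_C, PowerSeries.expand_X]

/-! ### From the recursion to the infinite product -/

section Recursion

variable (b : ℕ → ℕ → ℂ) (c : ℕ → ℂ) (z : ℂ)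

/-- The power series `∑ z ^ (n * l) * b k l * t ^ (n * l + k)`. -/
noncomputable def weightedSeries (n : ℕ) : PowerSeries ℂ :=
  PowerSeries.mk fun k => ∑ l ∈ (Finset.range (k + 1)).filter (fun l => n * l ≤ k),
    z ^ (n * l) * b (k - n * l) l

variable {b c z}

/-- Expanding each coefficient by `hrec` and writing `l = i + j`, the weight `z ^ (n * l) * z ^ j`
splits as `(z ^ n) ^ i * z ^ ((n + 1) * j)`, and the degree `(n + 1) * l` splits likewise. The
hypothesis `hb` discards the terms with `n * l ≤ k < (n + 1) * l`, to which `hrec` does not apply.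
-/
theorem weightedSeries_eq_mul (hb : ∀ k l, k < l → b k l = 0)
    (hrec : ∀ k l, b (k + l) l = ∑ p ∈ Finset.HasAntidiagonal.antidiagonal l, c p.1 * (z ^ p.2 * b k p.2))
    (n : ℕ) :
    weightedSeries b z n =
      PowerSeries.substMonomial (z ^ n) n (PowerSeries.mk c) * weightedSeries b z (n + 1) := by
  ext k
  rw [PowerSeries.coeff_substMonomial_mul]
  simp only [weightedSeries, PowerSeries.coeff_mk, Finset.mul_sum]
  have hL : ∑ l ∈ (Finset.range (k + 1)).filter (fun l => n * l ≤ k),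
      z ^ (n * l) * b (k - n * l) l =
      ∑ l ∈ (Finset.range (k + 1)).filter (fun l => (n + 1) * l ≤ k),
        ∑ p ∈ Finset.HasAntidiagonal.antidiagonal l,
          z ^ (n * l) * (c p.1 * (z ^ p.2 * b (k - (n + 1) * l) p.2)) := by
    symm
    rw [Finset.sum_subset_zero_on_sdiff (s₂ := (Finset.range (k + 1)).filter (fun l => n * l ≤ k))
      (g := fun l => z ^ (n * l) * b (k - n * l) l)]
    · intro l hl
      simp only [Finset.mem_filter, Finset.mem_range, add_mul, one_mul] at hl ⊢
      omega
    · intro l hl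
      simp only [Finset.mem_sdiff, Finset.mem_filter, add_mul, one_mul, not_and] at hl
      rw [hb _ _ (by have := hl.2 hl.1.1; omega), mul_zero]
    · intro l hl
      simp only [Finset.mem_filter, add_mul, one_mul] at hl
      have h : k - n * l = k - (n + 1) * l + l := by rw [add_mul, one_mul]; omega
      rw [← Finset.mul_sum, ← hrec, h]
  rw [hL, Finset.sum_sigma', Finset.sum_sigma']
  -- The index `l` is recovered as `i + j`.
  refine Finset.sum_bij' (fun x _ => ⟨x.2.1, x.2.2⟩) (fun y _ => ⟨y.1 + y.2, (y.1, y.2)⟩) ?_ ?_ ?_ ?_ ?_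
  · rintro ⟨l, i, j⟩ hx
    simp only [Finset.mem_sigma, Finset.mem_filter, Finset.mem_range, Finset.HasAntidiagonal.mem_antidiagonal] at hx ⊢
    obtain ⟨⟨h1, h2⟩, rfl⟩ := hx
    rw [mul_add] at h2
    have : j ≤ (n + 1) * j := Nat.le_mul_of_pos_left _ n.succ_pos
    omega
  · rintro ⟨i, j⟩ hx
    simp only [Finset.mem_sigma, Finset.mem_filter, Finset.mem_range, Finset.HasAntidiagonal.mem_antidiagonal] at hx ⊢
    rw [mul_add]
    have : j ≤ (n + 1) * j := Nat.le_mul_of_pos_left _ n.succ_pos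
    have : i ≤ (n + 1) * i := Nat.le_mul_of_pos_left _ n.succ_pos
    exact ⟨by omega, trivial⟩
  · rintro ⟨l, i, j⟩ hx
    simp only [Finset.mem_sigma, Finset.HasAntidiagonal.mem_antidiagonal] at hx
    obtain ⟨_, rfl⟩ := hx
    rfl
  · rintro ⟨i, j⟩ hx
    rfl
  · rintro ⟨l, i, j⟩ hx
    simp only [Finset.mem_sigma, Finset.HasAntidiagonal.mem_antidiagonal] at hx
    obtain ⟨_, rfl⟩ := hx
    simp only
    rw [mul_add (n + 1), Nat.sub_sub]
    ring

theorem weightedSeries_zero_eq_prod (hb : ∀ k l, k < l → b k l = 0)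
    (hrec : ∀ k l, b (k + l) l = ∑ p ∈ Finset.HasAntidiagonal.antidiagonal l, c p.1 * (z ^ p.2 * b k p.2))
    (n : ℕ) :
    weightedSeries b z 0 =
      (∏ i ∈ Finset.range n, PowerSeries.substMonomial (z ^ i) i (PowerSeries.mk c)) *
        weightedSeries b z n := by
  induction n with
  | zero => simp
  | succ n ih => rw [ih, weightedSeries_eq_mul hb hrec n, Finset.prod_range_succ, mul_assoc]

/-- Terms with `l > 0` start in degree at least `n`, so below that degree only `b k 0` is seen: the
series are congruent to `1` modulo `t ^ n`. -/
theorem coeff_weightedSeries_of_lt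
    (hb0 : ∀ k, b k 0 = if k = 0 then 1 else 0) {k n : ℕ} (hk : k < n) :
    PowerSeries.coeff k (weightedSeries b z n) = if k = 0 then 1 else 0 := by
  simp only [weightedSeries, PowerSeries.coeff_mk]
  rw [Finset.sum_eq_single 0]
  · simp [hb0]
  · intro l hl hl0
    simp only [Finset.mem_filter] at hl
    have : n ≤ n * l := Nat.le_mul_of_pos_right _ (Nat.pos_of_ne_zero hl0)
    omega
  · intro h
    simp at h

/-- The recursion telescopes: `Z` is the `k`-th partial product times a remainder that is `1` up to
degree `k`. -/
theorem hasFormalProd_of_recursion {q r m s : ℕ} (hQ : 1 < q ^ r)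
    (hb : ∀ k l, k < l → b k l = 0) (hb0 : ∀ k, b k 0 = if k = 0 then 1 else 0)
    (hrec : ∀ k l, b (k + l) l =
      ∑ p ∈ Finset.HasAntidiagonal.antidiagonal l, c p.1 * (((q : ℂ) ^ m) ^ p.2 * b k p.2))
    (hc : PowerSeries.mk c *
      ∏ j ∈ Finset.range m, (1 - PowerSeries.C ((q : ℂ) ^ j) * PowerSeries.X) ^ s = 1)
    (Z : ArithmeticFunction ℂ)
    (hZ : ∀ k, Z ((q ^ r) ^ k) = ∑ l ∈ Finset.range (k + 1), b k l)
    (hZ' : ∀ n, (∀ k, n ≠ (q ^ r) ^ k) → Z n = 0) :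
    HasFormalProd
      (fun n => ∏ j ∈ Finset.range m,
        Ring.inverse (1 - dirichletMonomial ((q : ℂ) ^ (j + m * n)) (q ^ (r * (n + 1)))) ^ s) Z := by
  have hZeq : Z = PowerSeries.toDirichlet _ hQ (weightedSeries b ((q : ℂ) ^ m) 0) := by
    ext n
    rw [PowerSeries.toDirichlet_apply]
    split_ifs with h
    · conv_lhs => rw [← h]
      rw [hZ]
      simp [weightedSeries]
    · exact hZ' n fun k hk => h (by rw [hk, Nat.log_pow hQ])
  have hfac : ∀ n, ∏ j ∈ Finset.range m,
        Ring.inverse (1 - dirichletMonomial ((q : ℂ) ^ (j + m * n)) (q ^ (r * (n + 1)))) ^ s =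
      PowerSeries.toDirichlet _ hQ
        (PowerSeries.substMonomial (((q : ℂ) ^ m) ^ n) n (PowerSeries.mk c)) := by
    intro n
    have h1 := congrArg (PowerSeries.toDirichlet _ hQ)
      (congrArg (PowerSeries.substMonomial (((q : ℂ) ^ m) ^ n) n) hc)
    rw [map_mul, map_mul, map_prod, map_prod, map_one, map_one] at h1
    have h4 : ∀ j, PowerSeries.toDirichlet _ hQ (PowerSeries.substMonomial (((q : ℂ) ^ m) ^ n) n
        ((1 - PowerSeries.C ((q : ℂ) ^ j) * PowerSeries.X) ^ s)) =
        (1 - dirichletMonomial ((q : ℂ) ^ j * ((q : ℂ) ^ m) ^ n) ((q ^ r) ^ (n + 1))) ^ s := by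
      intro j
      rw [map_pow, map_pow, PowerSeries.substMonomial_one_sub, map_sub, map_one,
        PowerSeries.toDirichlet_C_mul_X_pow]
    simp only [h4] at h1
    have h2 : ∏ j ∈ Finset.range m,
        (1 - dirichletMonomial ((q : ℂ) ^ j * ((q : ℂ) ^ m) ^ n) ((q ^ r) ^ (n + 1))) ^ s =
        ∏ j ∈ Finset.range m,
        (1 - dirichletMonomial ((q : ℂ) ^ (j + m * n)) (q ^ (r * (n + 1)))) ^ s := by
      simp only [pow_add, pow_mul]
    rw [h2] at h1
    have h3 : ∏ j ∈ Finset.range m,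
        Ring.inverse (1 - dirichletMonomial ((q : ℂ) ^ (j + m * n)) (q ^ (r * (n + 1)))) ^ s =
        Ring.inverse (∏ j ∈ Finset.range m,
          (1 - dirichletMonomial ((q : ℂ) ^ (j + m * n)) (q ^ (r * (n + 1)))) ^ s) := by
      -- `Ring.inverse` is multiplicative on a commutative ring even at non-units, so the inverses
      -- can be collected before invertibility is known; the transported identity `hc` then shows
      -- that the product is a unit.
      have := map_prod (MonoidWithZero.inverse (M := ArithmeticFunction ℂ))
        (fun j => (1 - dirichletMonomial ((q : ℂ) ^ (j + m * n)) (q ^ (r * (n + 1)))) ^ s)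
        (Finset.range m)
      simp only [map_pow] at this
      exact this.symm
    rw [h3]
    have hu := IsUnit.of_mul_eq_one _ ((mul_comm _ _).trans h1)
    exact ((Ring.eq_mul_inverse_iff_mul_eq _ _ _ hu).2 h1).trans (one_mul _) |>.symm
  intro N
  -- Enough factors: for `y ≤ N` the degree `log y` is at most `N`, hence below `k`, where the
  -- remainder is `1`.
  refine ⟨N + 1, fun k hk n hn => ?_⟩
  rw [hZeq, weightedSeries_zero_eq_prod hb hrec k, map_mul, map_prod, ArithmeticFunction.mul_apply]
  simp only [hfac]
  rcases Nat.eq_zero_or_pos n with rfl | hn0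
  · simp
  rw [Finset.sum_eq_single (n, 1)]
  · rw [PowerSeries.toDirichlet_apply]
    simp [coeff_weightedSeries_of_lt hb0 (show 0 < k by omega)]
  · rintro ⟨x, y⟩ hp hne
    simp only [Nat.mem_divisorsAntidiagonal] at hp
    have hy0 : y ≠ 0 := by rintro rfl; simp at hp; omega
    have hyn : y ≤ n := Nat.le_of_dvd hn0 ⟨x, by rw [← hp.1, mul_comm]⟩
    have hlog : Nat.log (q ^ r) y ≤ y := Nat.log_le_self _ _
    simp only [PowerSeries.toDirichlet_apply]
    rw [coeff_weightedSeries_of_lt hb0 (show Nat.log (q ^ r) y < k by omega)]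
    split_ifs with h1 h2
    · exfalso
      rw [h2, pow_zero] at h1
      subst h1
      exact hne (by simp [← hp.1])
    all_goals simp
  · intro h
    simp at h
    omega

end Recursion

/-! ### Consequences of invertibility -/

section Invertible

variable {R : Type u} [Ring R] (I : Ideal R) [I.IsTwoSided]

/-- The map `I ⊗_R N → N` induced by a bimodule homomorphism `d : I → R`. -/
def Ideal.tensorLift (d : I →ₗ[R] R) (hd : ∀ x a, d (I.rightMul x a) = d x * a) (N : Type u)
    [AddCommGroup N] [Module R N] : I.tensorObj N →ₗ[R] N :=
  (I.tensorRel N).liftQ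
    (TensorProduct.AlgebraTensorModule.lift (LinearMap.toSpanSingleton R (Module.End ℤ N) 1 ∘ₗ d))
    (by
      refine Submodule.span_le.2 ?_
      rintro _ ⟨x, a, n, rfl⟩
      simp [hd, mul_smul])

/-- The multiplication map `I ⊗_R N → N`. -/
def Ideal.tensorMul (N : Type u) [AddCommGroup N] [Module R N] : I.tensorObj N →ₗ[R] N :=
  I.tensorLift (Submodule.subtype I) (fun _ _ => rfl) N

variable {N N' : Type u} [AddCommGroup N] [Module R N] [AddCommGroup N'] [Module R N']

/-- The pure tensor `x ⊗ n` in `I ⊗_R N`. -/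
def Ideal.tmul (x : I) (n : N) : I.tensorObj N := (I.tensorRel N).mkQ (x ⊗ₜ[ℤ] n)

@[elab_as_elim]
theorem Ideal.tensorObj_induction {p : I.tensorObj N → Prop} (t : I.tensorObj N) (zero : p 0)
    (add : ∀ s t, p s → p t → p (s + t)) (tmul : ∀ (x : I) (n : N), p (I.tmul x n)) : p t := by
  obtain ⟨t, rfl⟩ := Submodule.mkQ_surjective _ t
  induction t using TensorProduct.induction_on with
  | zero => simpa using zero
  | tmul a b => exact tmul a b
  | add a b ha hb => rw [map_add]; exact add _ _ ha hb

theorem Ideal.tensorLift_tmul (d : I →ₗ[R] R) (hd : ∀ x a, d (I.rightMul x a) = d x * a)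
    (x : I) (n : N) : I.tensorLift d hd N (I.tmul x n) = d x • n := by
  change TensorProduct.AlgebraTensorModule.lift
    (LinearMap.toSpanSingleton R (Module.End ℤ N) 1 ∘ₗ d) (x ⊗ₜ[ℤ] n) = _
  simp

theorem Ideal.tensorMul_tmul (x : I) (n : N) : I.tensorMul N (I.tmul x n) = (x : R) • n :=
  I.tensorLift_tmul _ _ x n

theorem Ideal.tensorMap_tmul (f : N →ₗ[R] N') (x : I) (n : N) :
    I.tensorMap f (I.tmul x n) = I.tmul x (f n) := by
  simp [Ideal.tensorMap, Ideal.tmul]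

theorem Ideal.tmul_rightMul (x : I) (a : R) (n : N) :
    I.tmul (I.rightMul x a) n = I.tmul x (a • n) := by
  rw [Ideal.tmul, Ideal.tmul, ← sub_eq_zero, ← map_sub, Submodule.mkQ_apply,
    Submodule.Quotient.mk_eq_zero]
  exact Submodule.subset_span ⟨x, a, n, rfl⟩

theorem Ideal.tmul_add (x : I) (n n' : N) : I.tmul x (n + n') = I.tmul x n + I.tmul x n' := by
  simp [Ideal.tmul, TensorProduct.tmul_add]

theorem Ideal.add_tmul (x y : I) (n : N) : I.tmul (x + y) n = I.tmul x n + I.tmul y n := by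
  simp [Ideal.tmul, TensorProduct.add_tmul]

theorem Ideal.tmul_zero (x : I) : I.tmul x (0 : N) = 0 := by
  simp [Ideal.tmul]

theorem Ideal.zero_tmul (n : N) : I.tmul 0 n = 0 := by
  simp [Ideal.tmul]

theorem Ideal.tensorMap_add (f g : N →ₗ[R] N') :
    I.tensorMap (f + g) = I.tensorMap f + I.tensorMap g := by
  refine LinearMap.ext fun t => ?_
  induction t using I.tensorObj_induction with
  | zero => simp only [map_zero]
  | add s t hs ht => rw [map_add, map_add, hs, ht]
  | tmul x n => simp [Ideal.tensorMap_tmul, Ideal.tmul_add]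

theorem Ideal.tensorMap_zero : I.tensorMap (0 : N →ₗ[R] N') = 0 := by
  refine LinearMap.ext fun t => ?_
  induction t using I.tensorObj_induction with
  | zero => simp only [map_zero]
  | add s t hs ht => rw [map_add, map_add, hs, ht]
  | tmul x n => simp [Ideal.tensorMap_tmul, Ideal.tmul_zero]

theorem Ideal.tensorMap_sum {κ : Type*} (s : Finset κ) (f : κ → N →ₗ[R] N') :
    I.tensorMap (∑ k ∈ s, f k) = ∑ k ∈ s, I.tensorMap (f k) := by
  classical
  induction s using Finset.induction_on with
  | empty => simp [Ideal.tensorMap_zero]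
  | insert a s ha ih => rw [Finset.sum_insert ha, Finset.sum_insert ha, Ideal.tensorMap_add, ih]

theorem Ideal.tensorMul_tensorMap (f : N →ₗ[R] N') (t : I.tensorObj N) :
    I.tensorMul N' (I.tensorMap f t) = f (I.tensorMul N t) := by
  induction t using I.tensorObj_induction with
  | zero => simp only [map_zero]
  | add s t hs ht => simp only [map_add, hs, ht]
  | tmul x n => simp [Ideal.tensorMap_tmul, Ideal.tensorMul_tmul]

/-- The bridge between the functor `I ⊗ -` and the operation `X ↦ IX` on submodules. -/
theorem Ideal.range_tensorMul_comp_tensorMap (f : N →ₗ[R] N') :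
    LinearMap.range (I.tensorMul N' ∘ₗ I.tensorMap f) = I • LinearMap.range f := by
  apply le_antisymm
  · rintro _ ⟨t, rfl⟩
    induction t using I.tensorObj_induction with
    | zero => simp only [map_zero, zero_mem]
    | add s t hs ht => rw [map_add]; exact add_mem hs ht
    | tmul x n =>
      rw [LinearMap.comp_apply, Ideal.tensorMap_tmul, Ideal.tensorMul_tmul]
      exact Submodule.smul_mem_smul x.2 ⟨n, rfl⟩
  · refine Submodule.smul_le.2 ?_
    rintro a ha _ ⟨n, rfl⟩
    exact ⟨I.tmul ⟨a, ha⟩ n, by rw [LinearMap.comp_apply, Ideal.tensorMap_tmul, Ideal.tensorMul_tmul]⟩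

theorem Ideal.tensorMul_self_injective : Function.Injective (I.tensorMul R) := by
  have key : ∀ t : I.tensorObj R, ∃ x : I, t = I.tmul x 1 := by
    intro t
    induction t using I.tensorObj_induction with
    | zero => exact ⟨0, (I.zero_tmul 1).symm⟩
    | add s t hs ht =>
      obtain ⟨⟨x, rfl⟩, ⟨y, rfl⟩⟩ := And.intro hs ht
      exact ⟨x + y, (I.add_tmul x y 1).symm⟩
    | tmul x n => exact ⟨I.rightMul x n, by rw [Ideal.tmul_rightMul, smul_eq_mul, mul_one]⟩
  rw [injective_iff_map_eq_zero]
  intro t ht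
  obtain ⟨x, rfl⟩ := key t
  rw [Ideal.tensorMul_tmul, smul_eq_mul, mul_one] at ht
  rw [show x = 0 from Subtype.ext ht, Ideal.zero_tmul]

/-- The identity of `N` is a finite sum of endomorphisms factoring through `R`, so naturality of the
multiplication map reduces the claim to `N = R`, where every tensor has the form `x ⊗ 1`. -/
theorem Ideal.tensorMul_injective [Module.Finite R N] [Module.Projective R N] :
    Function.Injective (I.tensorMul N) := by
  obtain ⟨n, f, g, -, -, hfg⟩ := Module.Finite.exists_comp_eq_id_of_projective R N
  rw [injective_iff_map_eq_zero]
  intro t ht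
  classical
  have hid : (LinearMap.id : N →ₗ[R] N) =
      ∑ k : Fin n, (f ∘ₗ LinearMap.single R (fun _ => R) k) ∘ₗ (LinearMap.proj k ∘ₗ g) := by
    rw [← hfg]
    ext x
    have := congrArg f (Finset.univ_sum_single (g x))
    simp only [LinearMap.comp_apply, LinearMap.sum_apply, LinearMap.proj_apply]
    rw [← this, map_sum]
    rfl
  have h1 : t = I.tensorMap LinearMap.id t := by rw [I.tensorMap_id]; rfl
  rw [h1, hid, Ideal.tensorMap_sum, LinearMap.sum_apply]
  refine Finset.sum_eq_zero fun k _ => ?_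
  rw [Ideal.tensorMap_comp, LinearMap.comp_apply]
  have h2 : I.tensorMap (LinearMap.proj k ∘ₗ g) t = 0 := by
    apply I.tensorMul_self_injective
    rw [Ideal.tensorMul_tensorMap, ht, map_zero, map_zero]
  rw [h2, map_zero]

variable {I} {M : Type u} [AddCommGroup M] [Module R M]

/-- As `I ⊗ M ≃ IM`, the inclusion of `W` is a map `W → I ⊗ M`. Essential surjectivity gives `W ≃ I
⊗ W'`, fullness makes the map come from some `g : W' → M`, and the range of `g` is the required
submodule. -/
theorem Ideal.IsInvertible.exists_smul_eq [Module.Finite R M] [Module.Projective R M]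
    (hI : I.IsInvertible) {W : Submodule R M} (hW : W ≤ I • ⊤) : ∃ X : Submodule R M, I • X = W := by
  have : I.tensorFunctor.IsEquivalence := hI
  have hr : LinearMap.range (I.tensorMul M) = I • ⊤ := by
    have := I.range_tensorMul_comp_tensorMap (LinearMap.id : M →ₗ[R] M)
    rwa [I.tensorMap_id, LinearMap.range_id, LinearMap.comp_id] at this
  let E := LinearEquiv.ofInjective (I.tensorMul M) I.tensorMul_injective
  let j : W →ₗ[R] I.tensorObj M := E.symm.toLinearMap ∘ₗ Submodule.inclusion (hW.trans_eq hr.symm)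
  have hj : I.tensorMul M ∘ₗ j = W.subtype := by
    ext x
    have := E.apply_symm_apply (Submodule.inclusion (hW.trans_eq hr.symm) x)
    exact congrArg Subtype.val this
  let W' := I.tensorFunctor.objPreimage (ModuleCat.of R W)
  let i := (I.tensorFunctor.objObjPreimageIso (ModuleCat.of R W))
  let φ : I.tensorFunctor.obj W' ⟶ I.tensorFunctor.obj (ModuleCat.of R M) :=
    CategoryTheory.CategoryStruct.comp i.hom (ModuleCat.ofHom j)
  obtain ⟨g, hg⟩ := I.tensorFunctor.map_surjective φ
  refine ⟨LinearMap.range g.hom, ?_⟩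
  let ψ : I.tensorObj W' →ₗ[R] W := i.hom.hom
  have hg' : I.tensorMap g.hom = j ∘ₗ ψ := congrArg ModuleCat.Hom.hom hg
  rw [← I.range_tensorMul_comp_tensorMap, hg', ← LinearMap.comp_assoc, hj, LinearMap.range_comp,
    LinearMap.range_eq_top.2, Submodule.map_top, Submodule.range_subtype]
  exact (CategoryTheory.Iso.toLinearEquiv i).surjective

/-- By faithfulness it suffices that `X → M / Y` vanishes after tensoring with `I`. A tensor `x ⊗ n`
with `n ∈ X` has product in `IY`, so inside `I ⊗ M` it comes from `I ⊗ Y` and dies in `I ⊗ (M / Y)`.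
-/
theorem Ideal.IsInvertible.le_of_smul_le [Module.Finite R M] [Module.Projective R M]
    (hI : I.IsInvertible) {X Y : Submodule R M} (h : I • X ≤ I • Y) : X ≤ Y := by
  have : I.tensorFunctor.IsEquivalence := hI
  have hzero : I.tensorMap (Y.mkQ ∘ₗ X.subtype) = 0 := by
    refine LinearMap.ext fun t => ?_
    refine I.tensorObj_induction t (by simp only [map_zero]) (fun s t hs ht => by
      rw [map_add, map_add, hs, ht]) fun x n => ?_
    have hx : (x : R) • (n : M) ∈ I • Y := h (Submodule.smul_mem_smul x.2 n.2)
    have := I.range_tensorMul_comp_tensorMap Y.subtype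
    rw [Submodule.range_subtype] at this
    rw [← this] at hx
    obtain ⟨t, ht⟩ := hx
    have h1 : I.tensorMap Y.subtype t = I.tmul x (n : M) :=
      I.tensorMul_injective (ht.trans (I.tensorMul_tmul x _).symm)
    rw [Ideal.tensorMap_tmul, LinearMap.comp_apply, Submodule.subtype_apply,
      ← Ideal.tensorMap_tmul, ← h1, ← LinearMap.comp_apply, ← I.tensorMap_comp]
    have h2 : Y.mkQ ∘ₗ Y.subtype = 0 := by ext; simp
    rw [h2, Ideal.tensorMap_zero]
    rfl
  have h0 : ModuleCat.ofHom (Y.mkQ ∘ₗ X.subtype) = ModuleCat.ofHom 0 := by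
    apply I.tensorFunctor.map_injective
    apply ModuleCat.hom_ext
    exact hzero.trans I.tensorMap_zero.symm
  have h0' : Y.mkQ ∘ₗ X.subtype = 0 := congrArg ModuleCat.Hom.hom h0
  intro x hx
  have := LinearMap.congr_fun h0' ⟨x, hx⟩
  simpa using this

end Invertible

/-! ### Modules all of whose submodules of finite index are isomorphic -/

theorem Submodule.card_quotient_map_of_injective {R M N : Type*} [Ring R] [AddCommGroup M] [Module R M]
    [AddCommGroup N] [Module R N] {i : N →ₗ[R] M} (hi : Function.Injective i) (L : Submodule R N) :
    Nat.card (M ⧸ L.map i) = Nat.card (N ⧸ L) * Nat.card (M ⧸ LinearMap.range i) :=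
  AddSubgroup.index_map_of_injective L.toAddSubgroup (f := i.toAddMonoidHom) hi

section SelfSimilar

variable {R : Type*} {N : Type*} [Ring R] [AddCommGroup N] [Module R N]

/-- The number of submodules of `N` of index `Q ^ k` that are mapped onto `D` by `g`. -/
noncomputable def surjCount {D : Type*} [AddCommGroup D] [Module R D] (Q : ℕ) (g : N →ₗ[R] D)
    (k : ℕ) : ℕ :=
  {L : Submodule R N | Nat.card (N ⧸ L) = Q ^ k ∧ L.map g = ⊤}.ncard

/-- The generating series of the numbers of submodules of `N` that are mapped onto `D` by `g`. -/
noncomputable def surjSeries {D : Type*} [AddCommGroup D] [Module R D] (Q : ℕ) (g : N →ₗ[R] D) :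
    PowerSeries ℂ :=
  PowerSeries.mk fun k => (surjCount Q g k : ℂ)

variable {D : Type*} [AddCommGroup D] [Module R D] {V : Type*} [AddCommGroup V] [Module R V]

/-- Goursat's argument: the image of `L ∩ ker g'` in the simple module `V` is everything or zero,
and in the second case the image of `L` in `D × V` is the graph of a map `θ`. -/
theorem map_prod_eq_top_or_le_ker [IsSimpleModule R V] {g' : N →ₗ[R] D} {g : N →ₗ[R] V}
    {L : Submodule R N} (hL : L.map g' = ⊤) :
    L.map (g'.prod g) = ⊤ ∨ ∃ θ : D →ₗ[R] V, L ≤ LinearMap.ker (g - θ ∘ₗ g') := by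
  have hsurj : ∀ d : D, ∃ x ∈ L, g' x = d := fun d => by
    have : d ∈ L.map g' := hL ▸ Submodule.mem_top
    exact this
  rcases eq_bot_or_eq_top ((L ⊓ LinearMap.ker g').map g) with h | h
  · right
    have hker : ∀ x ∈ L, g' x = 0 → g x = 0 := fun x hx hx' => by
      have : g x ∈ (L ⊓ LinearMap.ker g').map g := ⟨x, ⟨hx, hx'⟩, rfl⟩
      rwa [h] at this
    obtain ⟨θ, hθ⟩ := LinearMap.exists_range_eq_graph (f := (g'.prod g) ∘ₗ L.subtype)
      (fun d => by
        obtain ⟨x, hx, rfl⟩ := hsurj d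
        exact ⟨⟨x, hx⟩, rfl⟩)
      (fun x y hxy => by
        have := hker (x - y) (sub_mem x.2 y.2) (by rw [map_sub, sub_eq_zero]; exact hxy)
        rw [map_sub, sub_eq_zero] at this
        exact this)
    refine ⟨θ, fun x hx => ?_⟩
    have hmem : (g' x, g x) ∈ θ.graph := hθ ▸ ⟨⟨x, hx⟩, rfl⟩
    rw [LinearMap.mem_graph_iff] at hmem
    rw [LinearMap.mem_ker, LinearMap.sub_apply, LinearMap.comp_apply, sub_eq_zero]
    exact hmem
  · left
    rw [eq_top_iff]
    rintro ⟨d, w⟩ -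
    obtain ⟨x, hx, rfl⟩ := hsurj d
    have : w - g x ∈ (L ⊓ LinearMap.ker g').map g := h ▸ Submodule.mem_top
    obtain ⟨y, ⟨hy, hy'⟩, hyw⟩ := this
    refine ⟨x + y, add_mem hx hy, ?_⟩
    replace hy' : g' y = 0 := hy'
    simp [hy', hyw]

/-- The kernel has index `Q` and is isomorphic to `N`, so transport to `N` lowers the exponent by
one: this is the factor `X`. The restriction of `g'` becomes another surjection `N → D`, which is
why `ha` must cover all surjections. -/
theorem surjCount_ker [IsSimpleModule R V] {Q : ℕ} (hQ : 1 < Q) (hV : Nat.card V = Q)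
    (hiso : ∀ X : Submodule R N, Finite (N ⧸ X) → Nonempty (X ≃ₗ[R] N))
    {a : PowerSeries ℂ} (ha : ∀ h : N →ₗ[R] D, Function.Surjective h → surjSeries Q h = a)
    {g' : N →ₗ[R] D} {g : N →ₗ[R] V} (hg : Function.Surjective (g'.prod g)) (θ : D →ₗ[R] V) (k : ℕ) :
    (({L : Submodule R N | (Nat.card (N ⧸ L) = Q ^ k ∧ L.map g' = ⊤) ∧
      L ≤ LinearMap.ker (g - θ ∘ₗ g')}.ncard : ℕ) : ℂ) = PowerSeries.coeff k (PowerSeries.X * a) := by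
  set H := LinearMap.ker (g - θ ∘ₗ g') with hH
  have hsurj : Function.Surjective (g - θ ∘ₗ g') := fun w => by
    obtain ⟨x, hx⟩ := hg (0, w)
    replace hx := Prod.mk.inj (show (g' x, g x) = (0, w) from hx)
    exact ⟨x, by simp [hx.1, hx.2]⟩
  have hcard : Nat.card (N ⧸ H) = Q :=
    (Nat.card_congr (LinearMap.quotKerEquivOfSurjective _ hsurj).toEquiv).trans hV
  have hfin : Finite (N ⧸ H) := Nat.finite_of_card_ne_zero (by omega)
  obtain ⟨e⟩ := hiso H hfin
  let i : N →ₗ[R] N := H.subtype ∘ₗ e.symm.toLinearMap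
  have hi : Function.Injective i := H.injective_subtype.comp e.symm.injective
  have hri : LinearMap.range i = H := by
    rw [LinearMap.range_comp, LinearEquiv.range, Submodule.map_top, Submodule.range_subtype]
  have hidx : ∀ L : Submodule R N, Nat.card (N ⧸ L.map i) = Nat.card (N ⧸ L) * Q := fun L => by
    rw [Submodule.card_quotient_map_of_injective hi, hri, hcard]
  cases k with
  | zero =>
    rw [PowerSeries.coeff_zero_X_mul, Nat.cast_eq_zero]
    convert Set.ncard_empty (Submodule R N)
    rw [Set.eq_empty_iff_forall_notMem]
    rintro L ⟨⟨h1, -⟩, h2⟩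
    have := hidx (L.comap i)
    rw [Submodule.map_comap_eq, hri, inf_eq_right.2 h2, h1, pow_zero] at this
    exact hQ.ne' (Nat.eq_one_of_mul_eq_one_left this.symm)
  | succ k =>
    have hsurj' : Function.Surjective (g' ∘ₗ i) := fun d => by
      -- A preimage of a point of the graph of `θ` lies in the kernel, so `g'` stays surjective
      -- there.
      obtain ⟨x, hx⟩ := hg (d, θ d)
      replace hx := Prod.mk.inj (show (g' x, g x) = (d, θ d) from hx)
      have hxH : x ∈ H := by simp [hH, hx.1, hx.2]
      rw [← hri] at hxH
      obtain ⟨y, rfl⟩ := hxH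
      exact ⟨y, hx.1⟩
    rw [PowerSeries.coeff_succ_X_mul, ← ha _ hsurj', surjSeries, PowerSeries.coeff_mk, surjCount]
    refine congrArg Nat.cast (Eq.trans ?_
      (Set.ncard_image_of_injective _ (Submodule.map_injective_of_injective hi)))
    congr 1
    ext L
    constructor
    · rintro ⟨⟨h1, h2⟩, h3⟩
      have hL : (L.comap i).map i = L := by rw [Submodule.map_comap_eq, hri, inf_eq_right.2 h3]
      refine ⟨L.comap i, ⟨?_, ?_⟩, hL⟩
      · have := hidx (L.comap i)
        rw [hL, h1, pow_succ] at this
        exact (Nat.eq_of_mul_eq_mul_right (by omega) this).symm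
      · rw [Submodule.map_comp, hL, h2]
    · rintro ⟨L, ⟨h1, h2⟩, rfl⟩
      refine ⟨⟨by rw [hidx, h1, pow_succ], ?_⟩, ?_⟩
      · rw [← Submodule.map_comp, h2]
      · rw [← hri]; exact LinearMap.map_le_range

/-- Among the submodules mapping onto `D`, those not mapping onto `D × V` are partitioned by the map
`θ` whose graph is their image. Each of the `|Hom(D, V)|` classes contributes `X * a`. -/
theorem surjSeries_prod [IsSimpleModule R V] [Finite D] {Q : ℕ} (hQ : 1 < Q) (hV : Nat.card V = Q)
    (hfin : ∀ k, {L : Submodule R N | Nat.card (N ⧸ L) = Q ^ k}.Finite)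
    (hiso : ∀ X : Submodule R N, Finite (N ⧸ X) → Nonempty (X ≃ₗ[R] N))
    {a : PowerSeries ℂ} (ha : ∀ h : N →ₗ[R] D, Function.Surjective h → surjSeries Q h = a)
    {g' : N →ₗ[R] D} {g : N →ₗ[R] V} (hg : Function.Surjective (g'.prod g)) :
    surjSeries Q (g'.prod g) =
      (1 - PowerSeries.C ((Nat.card (D →ₗ[R] V) : ℕ) : ℂ) * PowerSeries.X) * a := by
  classical
  have hVf : Finite V := Nat.finite_of_card_ne_zero (by omega)
  have hHom : Finite (D →ₗ[R] V) := Finite.of_injective _ DFunLike.coe_injective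
  have := Fintype.ofFinite (D →ₗ[R] V)
  have hg' : Function.Surjective g' := fun d => by
    obtain ⟨x, hx⟩ := hg (d, 0)
    exact ⟨x, congrArg Prod.fst hx⟩
  ext k
  let A := (hfin k).toFinset.filter fun L => L.map g' = ⊤
  have hA : ∀ L, L ∈ A ↔ Nat.card (N ⧸ L) = Q ^ k ∧ L.map g' = ⊤ := fun L => by
    simp [A]
  have hnotle : ∀ (L : Submodule R N) (θ : D →ₗ[R] V), L ≤ LinearMap.ker (g - θ ∘ₗ g') →
      L.map (g'.prod g) ≠ ⊤ := by
    intro L θ hL htop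
    obtain ⟨w, hw⟩ := @exists_ne V (IsSimpleModule.nontrivial R V) 0
    have : ((0, w) : D × V) ∈ L.map (g'.prod g) := htop ▸ Submodule.mem_top
    obtain ⟨x, hx, hxw⟩ := this
    replace hxw := Prod.mk.inj (show (g' x, g x) = (0, w) from hxw)
    have h1 := hL hx
    rw [LinearMap.mem_ker, LinearMap.sub_apply, LinearMap.comp_apply, hxw.1, hxw.2, map_zero,
      sub_zero] at h1
    exact hw h1
  have h1 : surjCount Q g' k = A.card := by
    rw [surjCount, ← Set.ncard_coe_finset]
    congr 1
    ext L
    exact (hA L).symm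
  have h2 : surjCount Q (g'.prod g) k = (A.filter fun L => L.map (g'.prod g) = ⊤).card := by
    rw [surjCount, ← Set.ncard_coe_finset]
    congr 1
    ext L
    rw [Finset.mem_coe, Finset.mem_filter, hA]
    constructor
    · rintro ⟨h1, h2⟩
      refine ⟨⟨h1, ?_⟩, h2⟩
      have := congrArg (Submodule.map (LinearMap.fst R D V)) h2
      rwa [← Submodule.map_comp, LinearMap.fst_prod, Submodule.map_top,
        LinearMap.range_eq_top.2 LinearMap.fst_surjective] at this
    · rintro ⟨⟨h1, -⟩, h2⟩
      exact ⟨h1, h2⟩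
  have h3 : (A.filter fun L => ¬ L.map (g'.prod g) = ⊤) =
      Finset.univ.biUnion fun θ : D →ₗ[R] V =>
        A.filter fun L => L ≤ LinearMap.ker (g - θ ∘ₗ g') := by
    ext L
    simp only [Finset.mem_filter, Finset.mem_biUnion, Finset.mem_univ, true_and]
    constructor
    · rintro ⟨hL, hne⟩
      obtain ⟨θ, hθ⟩ := (map_prod_eq_top_or_le_ker ((hA L).1 hL).2).resolve_left hne
      exact ⟨θ, hL, hθ⟩
    · rintro ⟨θ, hL, hθ⟩
      exact ⟨hL, hnotle L θ hθ⟩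
  have h4 : ∀ θ : D →ₗ[R] V, (((A.filter fun L => L ≤ LinearMap.ker (g - θ ∘ₗ g')).card : ℕ) : ℂ) =
      PowerSeries.coeff k (PowerSeries.X * a) := by
    intro θ
    rw [← surjCount_ker hQ hV hiso ha hg θ k, ← Set.ncard_coe_finset]
    congr 2
    ext L
    rw [Finset.mem_coe, Finset.mem_filter, hA]
    rfl
  have h5 : (((A.filter fun L => ¬ L.map (g'.prod g) = ⊤).card : ℕ) : ℂ) =
      (Nat.card (D →ₗ[R] V) : ℂ) * PowerSeries.coeff k (PowerSeries.X * a) := by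
    rw [h3, Finset.card_biUnion]
    · rw [Nat.cast_sum, Finset.sum_congr rfl fun θ _ => h4 θ]
      simp [Nat.card_eq_fintype_card]
    · intro θ _ θ' _ hne
      rw [Function.onFun, Finset.disjoint_left]
      intro L hL hL'
      rw [Finset.mem_filter, hA] at hL hL'
      apply hne
      ext d
      -- On `L` both `θ ∘ g'` and `θ' ∘ g'` equal `g`, and `g'` maps `L` onto `D`, so `θ = θ'`.
      have : d ∈ L.map g' := hL.1.2 ▸ Submodule.mem_top
      obtain ⟨x, hx, rfl⟩ := this
      have e1 := hL.2 hx
      have e2 := hL'.2 hx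
      rw [LinearMap.mem_ker, LinearMap.sub_apply, LinearMap.comp_apply, sub_eq_zero] at e1 e2
      rw [← e1, e2]
  have h6 : (surjCount Q g' k : ℂ) = surjCount Q (g'.prod g) k +
      (Nat.card (D →ₗ[R] V) : ℂ) * PowerSeries.coeff k (PowerSeries.X * a) := by
    rw [h1, h2, ← h5, ← Nat.cast_add, Finset.card_filter_add_card_filter_not]
  have h7 : PowerSeries.coeff k a = surjCount Q g' k := by
    rw [← ha g' hg', surjSeries, PowerSeries.coeff_mk]
  rw [sub_mul, one_mul, map_sub, mul_assoc, PowerSeries.coeff_C_mul, h7, h6, surjSeries,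
    PowerSeries.coeff_mk]
  ring

theorem surjSeries_eq_of_ker_eq {D' : Type*} [AddCommGroup D'] [Module R D'] {Q : ℕ}
    {g : N →ₗ[R] D} {g' : N →ₗ[R] D'} (hg : Function.Surjective g) (hg' : Function.Surjective g')
    (h : LinearMap.ker g = LinearMap.ker g') : surjSeries Q g = surjSeries Q g' := by
  have key : ∀ L : Submodule R N, L.map g = ⊤ ↔ L.map g' = ⊤ := fun L => by
    have h1 := LinearMap.map_eq_top_iff (LinearMap.range_eq_top.2 hg) (p := L)
    have h2 := LinearMap.map_eq_top_iff (LinearMap.range_eq_top.2 hg') (p := L)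
    rw [h1, h2, h]
  simp only [surjSeries, surjCount, key]

theorem card_pi_linearMap {κ : Type*} [Finite κ] (W : κ → Type*) [∀ a, AddCommGroup (W a)]
    [∀ a, Module R (W a)] :
    Nat.card (((a : κ) → W a) →ₗ[R] V) = ∏ᶠ a, Nat.card (W a →ₗ[R] V) := by
  classical
  have := Fintype.ofFinite κ
  rw [finprod_eq_prod_of_fintype, ← Nat.card_pi]
  exact Nat.card_congr (LinearMap.lsum R W ℕ).symm.toEquiv

/-- Simple factors are added one at a time. A new factor receives `q ^ j` homomorphisms from those
already present, where `j` counts the earlier factors of the same class, so within a class `j` runs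
through `0, 1, 2, …`. -/
theorem surjSeries_pi {κ ι : Type*} [Fintype κ] [Fintype ι] (τ : κ → ι) (W : κ → Type*)
    [∀ a, AddCommGroup (W a)] [∀ a, Module R (W a)] [∀ a, IsSimpleModule R (W a)]
    {q Q : ℕ} (hQ : 1 < Q) (hW : ∀ a, Nat.card (W a) = Q) [DecidableEq ι]
    (hHom : ∀ a b, Nat.card (W a →ₗ[R] W b) = if τ a = τ b then q else 1)
    (hfin : ∀ k, {L : Submodule R N | Nat.card (N ⧸ L) = Q ^ k}.Finite)
    (hiso : ∀ X : Submodule R N, Finite (N ⧸ X) → Nonempty (X ≃ₗ[R] N))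
    (T : Finset κ) (g : N →ₗ[R] ((a : T) → W a)) (hg : Function.Surjective g) :
    surjSeries Q g = (∏ i : ι, ∏ j ∈ Finset.range (T.filter fun a => τ a = i).card,
      (1 - PowerSeries.C ((q : ℂ) ^ j) * PowerSeries.X)) *
        PowerSeries.mk fun k => ({L : Submodule R N | Nat.card (N ⧸ L) = Q ^ k}.ncard : ℂ) := by
  classical
  have hWf : ∀ a, Finite (W a) := fun a => Nat.finite_of_card_ne_zero (by rw [hW]; omega)
  induction T using Finset.induction_on with
  | empty =>
    have : ∀ L : Submodule R N, L.map g = ⊤ := fun L => Subsingleton.elim _ _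
    simp [surjSeries, surjCount, this]
  | insert b T hb ih =>
    let ρ : ((a : (insert b T : Finset κ)) → W a) →ₗ[R] ((a : T) → W a) :=
      LinearMap.pi fun a => LinearMap.proj (⟨a, Finset.mem_insert_of_mem a.2⟩ : (insert b T : Finset κ))
    let π : ((a : (insert b T : Finset κ)) → W a) →ₗ[R] W b :=
      LinearMap.proj (⟨b, Finset.mem_insert_self b T⟩ : (insert b T : Finset κ))
    have hbij : Function.Bijective (ρ.prod π) := by
      constructor
      · intro x y hxy
        replace hxy := Prod.mk.inj (show (ρ x, π x) = (ρ y, π y) from hxy)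
        funext ⟨a, ha⟩
        rcases Finset.mem_insert.1 ha with rfl | ha'
        · exact hxy.2
        · exact congrFun hxy.1 ⟨a, ha'⟩
      · rintro ⟨x, y⟩
        refine ⟨fun a => if h : (a : κ) ∈ T then x ⟨a, h⟩ else
          if h' : b = a then h' ▸ y else 0, ?_⟩
        refine Prod.ext ?_ ?_
        · funext a
          change dite _ _ _ = _
          rw [dif_pos a.2]
        · change dite _ _ _ = _
          rw [dif_neg hb, dif_pos rfl]
    have hs : Function.Surjective ((ρ ∘ₗ g).prod (π ∘ₗ g)) := hbij.2.comp hg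
    have hser : surjSeries Q g = surjSeries Q ((ρ ∘ₗ g).prod (π ∘ₗ g)) := by
      refine surjSeries_eq_of_ker_eq hg hs ?_
      rw [show (ρ ∘ₗ g).prod (π ∘ₗ g) = (ρ.prod π) ∘ₗ g from rfl,
        LinearMap.ker_comp_of_ker_eq_bot _ (LinearMap.ker_eq_bot.2 hbij.1)]
    rw [hser, surjSeries_prod hQ (hW b) hfin hiso ih hs, ← mul_assoc]
    congr 1
    have hcard : Nat.card (((a : T) → W a) →ₗ[R] W b) =
        q ^ (T.filter fun a => τ a = τ b).card := by
      rw [card_pi_linearMap, finprod_eq_prod_of_fintype,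
        Finset.prod_coe_sort T (fun a => Nat.card (W a →ₗ[R] W b))]
      simp only [hHom]
      rw [← Finset.prod_filter, Finset.prod_const]
    rw [hcard]
    rw [← Finset.mul_prod_erase Finset.univ _ (Finset.mem_univ (τ b)),
      ← Finset.mul_prod_erase Finset.univ (fun i => ∏ j ∈ Finset.range
        ((insert b T).filter fun a => τ a = i).card, _) (Finset.mem_univ (τ b)), ← mul_assoc]
    congr 1
    · rw [Finset.filter_insert, if_pos rfl, Finset.card_insert_of_notMem (by simp [hb]),
        Finset.prod_range_succ, mul_comm]
      simp
    · refine Finset.prod_congr rfl fun i hi => ?_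
      rw [Finset.filter_insert, if_neg (Finset.ne_of_mem_erase hi).symm]

/-- The generating series of the numbers of submodules of finite index of a module `N` whose
submodules of finite index are all isomorphic. -/
theorem mk_card_submodules_mul {κ ι : Type*} [Fintype κ] [Fintype ι] (τ : κ → ι) (W : κ → Type*)
    [∀ a, AddCommGroup (W a)] [∀ a, Module R (W a)] [∀ a, IsSimpleModule R (W a)]
    {q Q m : ℕ} (hQ : 1 < Q) (hW : ∀ a, Nat.card (W a) = Q) [DecidableEq ι]
    (hHom : ∀ a b, Nat.card (W a →ₗ[R] W b) = if τ a = τ b then q else 1)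
    (hfin : ∀ k, {L : Submodule R N | Nat.card (N ⧸ L) = Q ^ k}.Finite)
    (hiso : ∀ X : Submodule R N, Finite (N ⧸ X) → Nonempty (X ≃ₗ[R] N))
    (g : N →ₗ[R] ((a : κ) → W a)) (hg : Function.Surjective g)
    (hsup : ∀ X : Submodule R N, Finite (N ⧸ X) → X.map g = ⊤ → X = ⊤)
    (hm : ∀ i, (Finset.univ.filter fun a => τ a = i).card = m) :
    (PowerSeries.mk fun k => ({L : Submodule R N | Nat.card (N ⧸ L) = Q ^ k}.ncard : ℂ)) *
      ∏ j ∈ Finset.range m, (1 - PowerSeries.C ((q : ℂ) ^ j) * PowerSeries.X) ^ Fintype.card ι =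
      1 := by
  classical
  let ρ : ((a : κ) → W a) →ₗ[R] ((a : (Finset.univ : Finset κ)) → W a) :=
    LinearMap.pi fun a => LinearMap.proj (a : κ)
  have hρ : Function.Bijective ρ := by
    constructor
    · intro x y hxy
      funext a
      exact congrFun hxy ⟨a, Finset.mem_univ a⟩
    · intro x
      exact ⟨fun a => x ⟨a, Finset.mem_univ a⟩, rfl⟩
  have hρg : Function.Surjective (ρ ∘ₗ g) := by
    rw [LinearMap.coe_comp]
    exact hρ.2.comp hg
  have h := surjSeries_pi τ W hQ hW hHom hfin hiso Finset.univ (ρ ∘ₗ g) hρg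
  -- By `hsup` the only submodule of finite index mapping onto the full semisimple quotient is `N`.
  have h1 : surjSeries Q (ρ ∘ₗ g) = 1 := by
    rw [surjSeries_eq_of_ker_eq hρg hg
      (LinearMap.ker_comp_of_ker_eq_bot _ (LinearMap.ker_eq_bot.2 hρ.1))]
    ext k
    rw [surjSeries, PowerSeries.coeff_mk, surjCount, PowerSeries.coeff_one]
    have hset : {L : Submodule R N | Nat.card (N ⧸ L) = Q ^ k ∧ L.map g = ⊤} =
        if k = 0 then {⊤} else ∅ := by
      ext L
      constructor
      · rintro ⟨h1, h2⟩
        have : Finite (N ⧸ L) := Nat.finite_of_card_ne_zero (by rw [h1]; positivity)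
        obtain rfl := hsup L this h2
        have hk : k = 0 := by
          rw [Nat.card_unique, eq_comm] at h1
          by_contra hk
          exact (Nat.one_lt_pow hk hQ).ne' h1
        simp [hk]
      · split_ifs with hk
        · rintro rfl
          refine ⟨by simp [hk], ?_⟩
          rw [Submodule.map_top, LinearMap.range_eq_top.2 hg]
        · simp
    rw [hset]
    split_ifs <;> simp
  simp only [hm, Finset.prod_const, Finset.card_univ] at h
  rw [h1] at h
  rw [mul_comm, Finset.prod_pow]
  exact h.symm

end SelfSimilar

/-! ### Homomorphisms from a projective module to a finite module -/

section Lifts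

variable {R : Type*} [Ring R] {M A B : Type*} [AddCommGroup M] [Module R M] [AddCommGroup A]
  [Module R A] [AddCommGroup B] [Module R B]

/-- Projectivity provides one lift, and subtracting it identifies all lifts with the maps into the
kernel. -/
theorem nonempty_lifts_equiv [Module.Projective R M] (ρ : A →ₗ[R] B) (φ : M →ₗ[R] B)
    (h : LinearMap.range φ ≤ LinearMap.range ρ) :
    Nonempty ({α : M →ₗ[R] A // ρ ∘ₗ α = φ} ≃ (M →ₗ[R] LinearMap.ker ρ)) := by
  obtain ⟨α₀, hα₀⟩ := Module.projective_lifting_property ρ.rangeRestrict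
    (φ.codRestrict (LinearMap.range ρ) fun x => h ⟨x, rfl⟩) ρ.surjective_rangeRestrict
  have h0 : ∀ x, ρ (α₀ x) = φ x := fun x => congrArg Subtype.val (LinearMap.congr_fun hα₀ x)
  refine ⟨
    { toFun := fun α => (α.1 - α₀).codRestrict (LinearMap.ker ρ) fun x => ?_
      invFun := fun β => ⟨(LinearMap.ker ρ).subtype ∘ₗ β + α₀, ?_⟩
      left_inv := fun α => ?_
      right_inv := fun β => ?_ }⟩
  · have := LinearMap.congr_fun α.2 x
    rw [LinearMap.mem_ker, LinearMap.sub_apply, map_sub, h0, sub_eq_zero]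
    exact this
  · ext x
    have : ρ (β x : A) = 0 := (β x).2
    simp [h0, this]
  · ext x
    simp
  · ext x
    simp

theorem card_linearMap_eq_mul [Module.Projective R M] (K : Submodule R A) :
    Nat.card (M →ₗ[R] A) = Nat.card (M →ₗ[R] A ⧸ K) * Nat.card (M →ₗ[R] K) := by
  rw [← Nat.card_prod, Nat.card_congr (Equiv.sigmaFiberEquiv
    (fun α : M →ₗ[R] A => K.mkQ ∘ₗ α)).symm]
  refine Nat.card_congr ((Equiv.sigmaCongrRight fun φ => ?_).trans (Equiv.sigmaEquivProd _ _))
  have h := nonempty_lifts_equiv K.mkQ φ (by simp)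
  rw [Submodule.ker_mkQ] at h
  exact h.some

end Lifts

/-! ### Lengths of finite modules and covering relations -/

section FiniteModules

variable {R : Type u} [Ring R] {M : Type v} [AddCommGroup M] [Module R M]

/-- Both cardinals are multiplicative along a composition series, and `k` is the length. The common
exponent is what converts an index into a number of homomorphisms. -/
theorem exists_card_eq_pow [Module.Projective R M] {Q w : ℕ}
    (hS : ∀ (S : Type u) [AddCommGroup S] [Module R S] [IsSimpleModule R S],
      Nat.card S = Q ∧ Nat.card (M →ₗ[R] S) = w)
    (E : Type u) [AddCommGroup E] [Module R E] [Finite E] :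
    ∃ k, Nat.card E = Q ^ k ∧ Nat.card (M →ₗ[R] E) = w ^ k := by
  have hE : IsFiniteLength R E := isFiniteLength_iff_isNoetherian_isArtinian.2
    ⟨inferInstance, inferInstance⟩
  induction hE with
  | of_subsingleton => exact ⟨0, by simp, by simp⟩
  | @of_simple_quotient E _ _ K _ _ ih =>
    obtain ⟨k, h1, h2⟩ := ih
    refine ⟨k + 1, ?_, ?_⟩
    · rw [Submodule.card_eq_card_quotient_mul_card K, h1, (hS (E ⧸ K)).1, pow_succ]
    · rw [card_linearMap_eq_mul K, h2, (hS (E ⧸ K)).2, pow_succ, mul_comm]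

theorem Submodule.relIndex_eq_card_quotient (A B : Submodule R M) :
    A.toAddSubgroup.relIndex B.toAddSubgroup = Nat.card (B ⧸ A.submoduleOf B) := rfl

theorem Submodule.finite_Ici (X : Submodule R M) [Finite (M ⧸ X)] : (Set.Ici X).Finite := by
  have : Finite (Submodule R (M ⧸ X)) := inferInstance
  have : Finite (Set.Ici X) := Finite.of_equiv _ (Submodule.comapMkQRelIso X).toEquiv
  exact Set.toFinite _

theorem Submodule.exists_covBy (X : Submodule R M) [Finite (M ⧸ X)] (hX : X ≠ ⊤) :
    ∃ Y, X ⋖ Y := by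
  have hfin : (Set.Ioi X).Finite := X.finite_Ici.subset Set.Ioi_subset_Ici_self
  obtain ⟨Y, hY⟩ := hfin.exists_minimal ⟨⊤, lt_top_iff_ne_top.2 hX⟩
  exact ⟨Y, hY.1, fun Z h1 h2 => h2.not_ge (hY.2 h1 h2.le)⟩

end FiniteModules

/-! ### Multiplication by an invertible ideal preserves indices -/

section Index

variable {R : Type u} [Ring R] {M : Type u} [AddCommGroup M] [Module R M]
  {I : Ideal R} [I.IsTwoSided]

/-- `X ↦ IX` is an order isomorphism onto the submodules of `IM`, so no submodule can appear
strictly between. -/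
theorem Ideal.IsInvertible.smul_covBy [Module.Finite R M] [Module.Projective R M]
    (hI : I.IsInvertible) {X Y : Submodule R M} (h : X ⋖ Y) : I • X ⋖ I • Y := by
  refine ⟨lt_of_le_not_ge (Submodule.smul_mono le_rfl h.le)
    fun h' => h.lt.not_ge (hI.le_of_smul_le h'), fun W h1 h2 => ?_⟩
  obtain ⟨Z, rfl⟩ := hI.exists_smul_eq (h2.le.trans (Submodule.smul_mono le_rfl le_top))
  refine h.2 (lt_of_le_not_ge (hI.le_of_smul_le h1.le) fun h' => ?_)
    (lt_of_le_not_ge (hI.le_of_smul_le h2.le) fun h' => ?_)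
  · exact h1.not_ge (Submodule.smul_mono le_rfl h')
  · exact h2.not_ge (Submodule.smul_mono le_rfl h')

theorem Submodule.relIndex_of_covBy {Q : ℕ}
    (hS : ∀ (S : Type u) [AddCommGroup S] [Module R S] [IsSimpleModule R S], Nat.card S = Q)
    {X Y : Submodule R M} (h : X ⋖ Y) : X.toAddSubgroup.relIndex Y.toAddSubgroup = Q := by
  have : IsSimpleModule R (Y ⧸ X.submoduleOf Y) := (covBy_iff_quot_is_simple h.le).1 h
  rw [Submodule.relIndex_eq_card_quotient]
  exact hS (Y ⧸ X.submoduleOf Y)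

/-- A saturated chain from `X` to `M` is carried to one from `IX` to `IM`. The simple subquotients
may change their isomorphism class but not their size, since all simple modules have `Q` elements.
-/
theorem Ideal.IsInvertible.relIndex_smul [Module.Finite R M] [Module.Projective R M] {Q : ℕ}
    (hI : I.IsInvertible) 
    (hS : ∀ (S : Type u) [AddCommGroup S] [Module R S] [IsSimpleModule R S], Nat.card S = Q)
    (hQ : 1 < Q) (X : Submodule R M) [Finite (M ⧸ X)] :
    (I • X).toAddSubgroup.relIndex (I • ⊤ : Submodule R M).toAddSubgroup = Nat.card (M ⧸ X) := by
  induction hn : Nat.card (M ⧸ X) using Nat.strong_induction_on generalizing X with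
  | _ n ih =>
  by_cases hX : X = ⊤
  · subst hX
    rw [AddSubgroup.relIndex_self, ← hn]
    simp
  · obtain ⟨Y, hY⟩ := X.exists_covBy hX
    have h1 : Nat.card (M ⧸ X) = Q * Nat.card (M ⧸ Y) := by
      rw [← Submodule.relIndex_of_covBy hS hY]
      exact (AddSubgroup.relIndex_mul_index
        (show X.toAddSubgroup ≤ Y.toAddSubgroup from hY.le)).symm
    have h0 : Nat.card (M ⧸ X) ≠ 0 := Nat.card_ne_zero.2 ⟨inferInstance, inferInstance⟩
    have hY0 : Nat.card (M ⧸ Y) ≠ 0 := fun h => h0 (by rw [h1, h, mul_zero])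
    have : Finite (M ⧸ Y) := Nat.finite_of_card_ne_zero hY0
    have hlt : Nat.card (M ⧸ Y) < n := by
      rw [← hn, h1]
      exact lt_mul_of_one_lt_left (Nat.pos_of_ne_zero hY0) hQ
    rw [← hn, h1, ← ih _ hlt Y rfl, ← Submodule.relIndex_of_covBy hS (hI.smul_covBy hY)]
    exact (AddSubgroup.relIndex_mul_relIndex _ _ _
      (show (I • X).toAddSubgroup ≤ (I • Y).toAddSubgroup from (hI.smul_covBy hY).le)
      (show (I • Y).toAddSubgroup ≤ (I • ⊤ : Submodule R M).toAddSubgroup from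
        Submodule.smul_mono le_rfl le_top)).symm

end Index

/-! ### Counting the submodules of `M` with prescribed image in `M / IM` -/

section QuotientIndex

variable {R : Type*} [Ring R] {M : Type*} [AddCommGroup M] [Module R M]

theorem Submodule.card_quotient_map_mkQ (K X : Submodule R M) :
    Nat.card ((M ⧸ K) ⧸ X.map K.mkQ) = Nat.card (M ⧸ X ⊔ K) := by
  have h := AddSubgroup.index_comap_of_surjective (X.map K.mkQ).toAddSubgroup
    (f := K.mkQ.toAddMonoidHom) K.mkQ_surjective
  have h2 : AddSubgroup.comap K.mkQ.toAddMonoidHom (X.map K.mkQ).toAddSubgroup =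
      (X ⊔ K).toAddSubgroup := by
    rw [sup_comm, ← Submodule.comap_map_mkQ]
    rfl
  rw [h2] at h
  exact h.symm

theorem Submodule.card_quotient_eq_mul (K X : Submodule R M) :
    Nat.card (M ⧸ X) =
      (X ⊓ K).toAddSubgroup.relIndex K.toAddSubgroup * Nat.card ((M ⧸ K) ⧸ X.map K.mkQ) := by
  have h1 : (X ⊓ K).toAddSubgroup.relIndex K.toAddSubgroup =
      X.toAddSubgroup.relIndex (X ⊔ K).toAddSubgroup := by
    have h := AddSubgroup.relIndex_sup_right K.toAddSubgroup X.toAddSubgroup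
    rw [← Submodule.sup_toAddSubgroup, sup_comm] at h
    rw [h]
    exact AddSubgroup.inf_relIndex_right X.toAddSubgroup K.toAddSubgroup
  rw [Submodule.card_quotient_map_mkQ, h1]
  exact (AddSubgroup.relIndex_mul_index
    (show X.toAddSubgroup ≤ (X ⊔ K).toAddSubgroup from
      (le_sup_left : X ≤ X ⊔ K))).symm

end QuotientIndex

section Fiber

variable {R : Type u} [Ring R] {M : Type u} [AddCommGroup M] [Module R M]
  {I : Ideal R} [I.IsTwoSided] [Module.Finite R M] [Module.Projective R M]

/-- Both `[M : X]` and `[IM : IX]` contain the factor `[IM : X ∩ IM]`; as they are equal, the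
complementary factors agree. -/
theorem Ideal.IsInvertible.relIndex_smul_inf (hI : I.IsInvertible) {Q : ℕ} (hQ : 1 < Q)
    (hS : ∀ (S : Type u) [AddCommGroup S] [Module R S] [IsSimpleModule R S], Nat.card S = Q)
    {K : Submodule R M} (hK : K = I • ⊤) (X : Submodule R M) [Finite (M ⧸ X)] :
    (I • X).toAddSubgroup.relIndex (X ⊓ K).toAddSubgroup = Nat.card ((M ⧸ K) ⧸ X.map K.mkQ) := by
  subst hK
  have h1 := hI.relIndex_smul hS hQ X
  have h2 := AddSubgroup.relIndex_mul_relIndex (I • X).toAddSubgroup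
    (X ⊓ I • ⊤ : Submodule R M).toAddSubgroup (I • ⊤ : Submodule R M).toAddSubgroup
    (show I • X ≤ X ⊓ I • ⊤ from le_inf Submodule.smul_le_right (Submodule.smul_mono le_rfl le_top))
    (show X ⊓ I • ⊤ ≤ I • ⊤ from inf_le_right)
  have h3 := Submodule.card_quotient_eq_mul (I • ⊤ : Submodule R M) X
  have h0 : Nat.card (M ⧸ X) ≠ 0 := Nat.card_ne_zero.2 ⟨inferInstance, inferInstance⟩
  rw [h1, h3, mul_comm] at h2
  refine Nat.eq_of_mul_eq_mul_left (Nat.pos_of_ne_zero fun h => h0 ?_) h2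
  rw [h3, h, zero_mul]

/-- Such an `X` amounts to a submodule of `A = X' / IX'` mapped isomorphically onto `L`. Since `L ≃
M / K`, this is the image of a unique lift to `A` of the map `φ : M → L` with kernel `K`. -/
theorem Ideal.IsInvertible.card_fiber (hI : I.IsInvertible) {Q w : ℕ} (hQ : 1 < Q)
    (hS : ∀ (S : Type u) [AddCommGroup S] [Module R S] [IsSimpleModule R S],
      Nat.card S = Q ∧ Nat.card (M →ₗ[R] S) = w)
    {K X' : Submodule R M} (hK : K = I • ⊤) [Finite (M ⧸ X')] {L : Submodule R (M ⧸ K)}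
    (e : L ≃ₗ[R] (M ⧸ K)) {l : ℕ} (hl : Nat.card ((M ⧸ K) ⧸ X'.map K.mkQ) = Q ^ l)
    (hL : L ≤ X'.map K.mkQ) :
    {X : Submodule R M | X ⊓ K = I • X' ∧ X.map K.mkQ = L}.ncard = w ^ l := by
  have hIXK : I • X' ≤ K := hK ▸ Submodule.smul_mono le_rfl le_top
  let P := (I • X').mkQ
  let A := X'.map P
  let ρ : A →ₗ[R] M ⧸ K := (I • X').liftQ K.mkQ (by rwa [Submodule.ker_mkQ]) ∘ₗ A.subtype
  have hρ' : ∀ (a : A) (x : M), (a : M ⧸ I • X') = P x → ρ a = K.mkQ x := by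
    rintro ⟨a, ha⟩ x rfl
    rfl
  let φ : M →ₗ[R] M ⧸ K := L.subtype ∘ₗ e.symm.toLinearMap ∘ₗ K.mkQ
  have hφr : LinearMap.range φ = L := by
    rw [LinearMap.range_comp, LinearMap.range_comp, Submodule.range_mkQ, Submodule.map_top,
      LinearEquiv.range, Submodule.map_top, Submodule.range_subtype]
  have hφk : ∀ x, φ x = 0 ↔ x ∈ K := fun x => by
    change ((e.symm (K.mkQ x) : L) : M ⧸ K) = 0 ↔ _
    rw [ZeroMemClass.coe_eq_zero, LinearEquiv.map_eq_zero_iff, Submodule.mkQ_apply,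
      Submodule.Quotient.mk_eq_zero]
  have hρr : LinearMap.range ρ = X'.map K.mkQ := by
    ext y
    constructor
    · rintro ⟨⟨a, x, hx, rfl⟩, rfl⟩
      exact ⟨x, hx, rfl⟩
    · rintro ⟨x, hx, rfl⟩
      exact ⟨⟨P x, x, hx, rfl⟩, rfl⟩
  obtain ⟨E⟩ := nonempty_lifts_equiv ρ φ (by rw [hφr, hρr]; exact hL)
  -- the kernel of `ρ` is `(X' ∩ IM) / IX'`
  have hker : Nat.card (LinearMap.ker ρ) = Q ^ l := by
    rw [← hl, ← hI.relIndex_smul_inf hQ (fun S => (hS S).1) hK X']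
    have h1 : (LinearMap.ker ρ).map A.subtype = (X' ⊓ K).map P := by
      ext y
      constructor
      · rintro ⟨⟨a, x, hx, rfl⟩, h, rfl⟩
        refine ⟨x, ⟨hx, ?_⟩, rfl⟩
        have h' : K.mkQ x = 0 := h
        rwa [Submodule.mkQ_apply, Submodule.Quotient.mk_eq_zero] at h'
      · rintro ⟨x, ⟨hx, hx'⟩, rfl⟩
        refine ⟨⟨P x, x, hx, rfl⟩, ?_, rfl⟩
        change K.mkQ x = 0
        rwa [Submodule.mkQ_apply, Submodule.Quotient.mk_eq_zero]
    rw [Nat.card_congr (Submodule.equivMapOfInjective A.subtype A.injective_subtype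
      (LinearMap.ker ρ)).toEquiv, h1]
    have h2 := AddSubgroup.relIndex_ker (X' ⊓ K).toAddSubgroup P.toAddMonoidHom
    have h3 : P.toAddMonoidHom.ker = (I • X').toAddSubgroup := by
      ext x
      change P x = 0 ↔ x ∈ I • X'
      rw [Submodule.mkQ_apply, Submodule.Quotient.mk_eq_zero]
    rw [h3] at h2
    exact h2.symm
  have hfink : Finite (LinearMap.ker ρ) := Nat.finite_of_card_ne_zero (by rw [hker]; positivity)
  -- The kernel has `Q ^ l` elements, hence length `l`, hence `w ^ l` homomorphisms from `M`.
  obtain ⟨k, hk1, hk2⟩ := exists_card_eq_pow hS (LinearMap.ker ρ)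
  obtain rfl : k = l := Nat.pow_right_injective hQ (hk1.symm.trans hker)
  rw [← hk2, ← Nat.card_congr E]
  symm
  let F : {α : M →ₗ[R] A // ρ ∘ₗ α = φ} → Submodule R M := fun α =>
    (LinearMap.range (A.subtype ∘ₗ α.1)).comap P
  have hF : ∀ α x, x ∈ F α ↔ ∃ y, (α.1 y : M ⧸ I • X') = P x := fun α x => Iff.rfl
  -- Every map `M → A` kills `K = IM`, because `I` annihilates `A`.
  have hαK : ∀ (α : {α : M →ₗ[R] A // ρ ∘ₗ α = φ}) (x : M), x ∈ K → α.1 x = 0 := by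
    intro α x hx
    have h1 : α.1 x ∈ I • (⊤ : Submodule R A) := by
      have hx' : x ∈ I • (⊤ : Submodule R M) := hK ▸ hx
      have : α.1 x ∈ (I • (⊤ : Submodule R M)).map α.1 := ⟨x, hx', rfl⟩
      rw [Submodule.map_smul''] at this
      exact Submodule.smul_mono le_rfl le_top this
    have h2 : I • (⊤ : Submodule R A) = ⊥ := by
      rw [eq_bot_iff, Submodule.smul_le]
      rintro a ha ⟨_, y, hy, rfl⟩ -
      rw [Submodule.mem_bot]
      apply Subtype.ext
      change a • P y = 0
      rw [← map_smul, Submodule.mkQ_apply, Submodule.Quotient.mk_eq_zero]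
      exact Submodule.smul_mem_smul ha hy
    rwa [h2, Submodule.mem_bot] at h1
  have hαφ : ∀ (α : {α : M →ₗ[R] A // ρ ∘ₗ α = φ}) (x : M), ρ (α.1 x) = φ x :=
    fun α x => LinearMap.congr_fun α.2 x
  have hinj : Function.Injective F := by
    intro α α' h
    apply Subtype.ext
    ext x
    obtain ⟨y, hy⟩ := Submodule.mkQ_surjective _ (α.1 x : M ⧸ I • X')
    have h1 : y ∈ F α' := h ▸ (hF α y).2 ⟨x, hy.symm⟩
    obtain ⟨x', hx'⟩ := (hF α' y).1 h1
    -- Equal images give `α x = α' x'`; applying `ρ` shows that `x` and `x'` agree modulo `K`, which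
    -- `α'` kills.
    have h2 : φ x = φ x' := by
      rw [← hαφ α, ← hαφ α', hρ' _ _ hy.symm, hρ' _ _ hx']
    have h3 : x' - x ∈ K := by rw [← hφk, map_sub, h2, sub_self]
    have h4 := hαK α' _ h3
    rw [map_sub, sub_eq_zero] at h4
    rw [← hy, ← h4]
    exact hx'.symm
  rw [← Nat.card_coe_set_eq]
  refine Nat.card_congr (Equiv.ofBijective (fun α => ⟨F α, ?_, ?_⟩) ⟨?_, ?_⟩)
  · ext x
    constructor
    · rintro ⟨hx, hxK⟩
      obtain ⟨y, hy⟩ := (hF α x).1 hx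
      have h1 : φ y = 0 := by
        rw [← hαφ α, hρ' _ _ hy, Submodule.mkQ_apply, Submodule.Quotient.mk_eq_zero]
        exact hxK
      rw [hαK α y ((hφk y).1 h1)] at hy
      exact (Submodule.Quotient.mk_eq_zero _).1 hy.symm
    · intro hx
      refine ⟨(hF α x).2 ⟨0, ?_⟩, hIXK hx⟩
      rw [map_zero]
      exact ((Submodule.Quotient.mk_eq_zero _).2 hx).symm
  · rw [← hφr]
    ext y
    constructor
    · rintro ⟨x, hx, rfl⟩
      obtain ⟨z, hz⟩ := (hF α x).1 hx
      exact ⟨z, by rw [← hαφ α, hρ' _ _ hz]⟩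
    · rintro ⟨z, rfl⟩
      obtain ⟨x, hx⟩ := Submodule.mkQ_surjective _ (α.1 z : M ⧸ I • X')
      exact ⟨x, (hF α x).2 ⟨z, hx.symm⟩, by rw [← hαφ α, hρ' _ _ hx.symm]⟩
  · intro α α' h
    exact hinj (congrArg Subtype.val h)
  · rintro ⟨X, hX1, hX2⟩
    have hXX' : X ≤ X' := hI.le_of_smul_le (by
      rw [← hX1, hK]
      exact le_inf Submodule.smul_le_right (Submodule.smul_mono le_rfl le_top))
    -- A given `X` arises by lifting `φ` along `X → L` and reducing the result modulo `IX'`.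
    obtain ⟨α₀, hα₀⟩ := Module.projective_lifting_property
      ((K.mkQ ∘ₗ X.subtype).rangeRestrict)
      (φ.codRestrict (LinearMap.range (K.mkQ ∘ₗ X.subtype)) fun x => by
        rw [LinearMap.range_comp, Submodule.range_subtype, hX2, ← hφr]
        exact ⟨x, rfl⟩) (LinearMap.surjective_rangeRestrict _)
    have h0 : ∀ x, K.mkQ (α₀ x) = φ x := fun x => congrArg Subtype.val (LinearMap.congr_fun hα₀ x)
    let α : M →ₗ[R] A := (P ∘ₗ X.subtype ∘ₗ α₀).codRestrict A fun x =>
      ⟨α₀ x, hXX' (α₀ x).2, rfl⟩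
    refine ⟨⟨α, LinearMap.ext fun x => (h0 x)⟩, Subtype.ext ?_⟩
    ext x
    change x ∈ F _ ↔ x ∈ X
    rw [hF]
    constructor
    · rintro ⟨y, hy⟩
      have h1 : P (α₀ y) = P x := hy
      rw [← sub_eq_zero, ← map_sub, Submodule.mkQ_apply, Submodule.Quotient.mk_eq_zero, ← hX1] at h1
      have := X.sub_mem (α₀ y).2 h1.1
      rwa [sub_sub_cancel] at this
    · intro hx
      have h1 : K.mkQ x ∈ LinearMap.range φ := by
        rw [hφr, ← hX2]
        exact ⟨x, hx, rfl⟩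
      obtain ⟨y, hy⟩ := h1
      refine ⟨y, ?_⟩
      change P (α₀ y) = P x
      rw [← sub_eq_zero, ← map_sub, Submodule.mkQ_apply, Submodule.Quotient.mk_eq_zero, ← hX1]
      refine ⟨X.sub_mem (α₀ y).2 hx, ?_⟩
      rw [← h0, ← sub_eq_zero, ← map_sub, Submodule.mkQ_apply, Submodule.Quotient.mk_eq_zero] at hy
      exact hy

end Fiber

/-! ### The recursion for the numbers of submodules -/

/-- The number of submodules of index `Q ^ j`. -/
noncomputable def indexCount (R : Type*) (N : Type*) [Ring R] [AddCommGroup N] [Module R N]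
    (Q j : ℕ) : ℕ :=
  {L : Submodule R N | Nat.card (N ⧸ L) = Q ^ j}.ncard

/-- The number of submodules `X` of `M` such that `X` has index `Q ^ k` in `M` and the image of
`X` has index `Q ^ l` in `M / K`. -/
noncomputable def bigradedCount {R : Type*} {M : Type*} [Ring R] [AddCommGroup M] [Module R M]
    (K : Submodule R M) (Q k l : ℕ) : ℕ :=
  {X : Submodule R M | Nat.card (M ⧸ X) = Q ^ k ∧ Nat.card ((M ⧸ K) ⧸ X.map K.mkQ) = Q ^ l}.ncard

section

variable {R : Type*} [Ring R] {N : Type*} [AddCommGroup N] [Module R N]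

/-- Transport along `N ≃ H` divides the index by `Q ^ l'`; if `l < l'`, divisibility of indices
leaves nothing. -/
theorem ncard_le_of_isomorphic {Q l l' : ℕ} (hQ : 1 < Q)
    {H : Submodule R N} (hH : Nat.card (N ⧸ H) = Q ^ l') (e : H ≃ₗ[R] N) :
    {L : Submodule R N | Nat.card (N ⧸ L) = Q ^ l ∧ L ≤ H}.ncard =
      if l' ≤ l then indexCount R N Q (l - l') else 0 := by
  let i : N →ₗ[R] N := H.subtype ∘ₗ e.symm.toLinearMap
  have hi : Function.Injective i := H.injective_subtype.comp e.symm.injective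
  have hri : LinearMap.range i = H := by
    rw [LinearMap.range_comp, LinearEquiv.range, Submodule.map_top, Submodule.range_subtype]
  have hidx : ∀ L : Submodule R N, Nat.card (N ⧸ L.map i) = Nat.card (N ⧸ L) * Q ^ l' :=
    fun L => by rw [Submodule.card_quotient_map_of_injective hi, hri, hH]
  have hcomap : ∀ L ≤ H, (L.comap i).map i = L := fun L hL => by
    rw [Submodule.map_comap_eq, hri, inf_eq_right.2 hL]
  split_ifs with hl
  · rw [indexCount]
    refine Eq.trans ?_ (Set.ncard_image_of_injective _ (Submodule.map_injective_of_injective hi))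
    congr 1
    ext L
    constructor
    · rintro ⟨h1, h2⟩
      refine ⟨L.comap i, ?_, hcomap L h2⟩
      have := hidx (L.comap i)
      rw [hcomap L h2, h1] at this
      refine Nat.eq_of_mul_eq_mul_right (pow_pos (by omega : 0 < Q) l') (this.symm.trans ?_)
      rw [← pow_add, Nat.sub_add_cancel hl]
    · rintro ⟨L, h1, rfl⟩
      refine ⟨?_, ?_⟩
      · rw [hidx, show Nat.card (N ⧸ L) = _ from h1, ← pow_add, Nat.sub_add_cancel hl]
      · rw [← hri]; exact LinearMap.map_le_range
  · convert Set.ncard_empty (Submodule R N)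
    rw [Set.eq_empty_iff_forall_notMem]
    rintro L ⟨h1, h2⟩
    have := hidx (L.comap i)
    rw [hcomap L h2, h1] at this
    exact hl ((Nat.pow_dvd_pow_iff_le_right hQ).1 ⟨_, this.trans (mul_comm _ _)⟩)

variable {K : Submodule R N}

theorem bigradedCount_of_lt {Q k l : ℕ} (hQ : 1 < Q) (h : k < l) : bigradedCount K Q k l = 0 := by
  rw [bigradedCount]
  convert Set.ncard_empty (Submodule R N)
  rw [Set.eq_empty_iff_forall_notMem]
  rintro X ⟨h1, h2⟩
  have := Submodule.card_quotient_eq_mul K X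
  rw [h1, h2] at this
  exact h.not_ge ((Nat.pow_dvd_pow_iff_le_right hQ).1 ⟨_, this.trans (mul_comm _ _)⟩)

theorem Submodule.card_quotient_eq_one_iff {X : Submodule R N} : Nat.card (N ⧸ X) = 1 ↔ X = ⊤ := by
  rw [Nat.card_eq_one_iff_unique, Submodule.Quotient.subsingleton_iff]
  exact ⟨fun h => h.1, fun h => ⟨h, inferInstance⟩⟩

theorem bigradedCount_zero {Q : ℕ} (hQ : 1 < Q)
    (hsup : ∀ X : Submodule R N, Finite (N ⧸ X) → X ⊔ K = ⊤ → X = ⊤) (k : ℕ) :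
    bigradedCount K Q k 0 = if k = 0 then 1 else 0 := by
  have hset : {X : Submodule R N | Nat.card (N ⧸ X) = Q ^ k ∧
      Nat.card ((N ⧸ K) ⧸ X.map K.mkQ) = Q ^ 0} = if k = 0 then {⊤} else ∅ := by
    ext X
    constructor
    · rintro ⟨h1, h2⟩
      have hf : Finite (N ⧸ X) := Nat.finite_of_card_ne_zero (by rw [h1]; positivity)
      rw [Submodule.card_quotient_map_mkQ, pow_zero, Submodule.card_quotient_eq_one_iff] at h2
      have hX := hsup X hf h2
      have hk : k = 0 := by
        rw [Submodule.card_quotient_eq_one_iff.2 hX] at h1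
        by_contra hk
        exact (Nat.one_lt_pow hk hQ).ne h1
      simp [hk, hX]
    · split_ifs with hk
      · rintro rfl
        refine ⟨by rw [hk, pow_zero, Submodule.card_quotient_eq_one_iff], ?_⟩
        rw [Submodule.card_quotient_map_mkQ, pow_zero, Submodule.card_quotient_eq_one_iff, top_sup_eq]
      · simp
  rw [bigradedCount, hset]
  split_ifs <;> simp

end

section Recursion

variable {R : Type u} [Ring R] {M : Type u} [AddCommGroup M] [Module R M]
  {I : Ideal R} [I.IsTwoSided] [Module.Projective R M]

theorem exists_log_card_quotient {Q w : ℕ} (hQ : 1 < Q)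
    (hS : ∀ (S : Type u) [AddCommGroup S] [Module R S] [IsSimpleModule R S],
      Nat.card S = Q ∧ Nat.card (M →ₗ[R] S) = w)
    (K X : Submodule R M) (hX : Finite (M ⧸ X)) :
    Nat.card ((M ⧸ K) ⧸ X.map K.mkQ) = Q ^ Nat.log Q (Nat.card ((M ⧸ K) ⧸ X.map K.mkQ)) := by
  have h0 : Nat.card (M ⧸ X) ≠ 0 := Nat.card_ne_zero.2 ⟨inferInstance, inferInstance⟩
  have : Finite ((M ⧸ K) ⧸ X.map K.mkQ) := Nat.finite_of_card_ne_zero fun h => h0 (by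
    rw [Submodule.card_quotient_eq_mul K X, h, mul_zero])
  obtain ⟨k, hk, -⟩ := exists_card_eq_pow hS ((M ⧸ K) ⧸ X.map K.mkQ)
  rw [hk, Nat.log_pow hQ]

theorem indexCount_eq_sum_bigradedCount {Q w : ℕ} (hQ : 1 < Q)
    (hS : ∀ (S : Type u) [AddCommGroup S] [Module R S] [IsSimpleModule R S],
      Nat.card S = Q ∧ Nat.card (M →ₗ[R] S) = w)
    (hfin : ∀ k, {X : Submodule R M | Nat.card (M ⧸ X) = Q ^ k}.Finite) (K : Submodule R M) (k : ℕ) :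
    indexCount R M Q k = ∑ l ∈ Finset.range (k + 1), bigradedCount K Q k l := by
  classical
  rw [indexCount, Set.ncard_eq_toFinset_card _ (hfin k)]
  rw [Finset.card_eq_sum_card_fiberwise (t := Finset.range (k + 1))
    (f := fun X => Nat.log Q (Nat.card ((M ⧸ K) ⧸ X.map K.mkQ)))]
  · refine Finset.sum_congr rfl fun l _ => ?_
    rw [bigradedCount, ← Set.ncard_coe_finset]
    congr 1
    ext X
    rw [Finset.mem_coe, Finset.mem_filter, Set.Finite.mem_toFinset]
    constructor
    · rintro ⟨h1, rfl⟩
      exact ⟨h1, exists_log_card_quotient hQ hS K X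
        (Nat.finite_of_card_ne_zero (by rw [show Nat.card (M ⧸ X) = _ from h1]; positivity))⟩
    · rintro ⟨h1, h2⟩
      exact ⟨h1, by rw [h2, Nat.log_pow hQ]⟩
  · intro X hX
    rw [Finset.mem_coe, Set.Finite.mem_toFinset] at hX
    have h1 : Nat.card (M ⧸ X) = Q ^ k := hX
    have h2 := exists_log_card_quotient hQ hS K X
      (Nat.finite_of_card_ne_zero (by rw [h1]; positivity))
    have h3 := Submodule.card_quotient_eq_mul K X
    rw [h1, h2] at h3
    have := (Nat.pow_dvd_pow_iff_le_right hQ).1 ⟨_, h3.trans (mul_comm _ _)⟩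
    simp only [Finset.coe_range, Set.mem_Iio]
    omega

/-- The submodules `X` are fibred over the pairs `(X', L)`, with `X'` of index `Q ^ k` and `L` of
index `Q ^ l`. The summand with `p.2 = j` collects the `X'` whose image has index `Q ^ j`. -/
theorem Ideal.IsInvertible.bigradedCount_add [Module.Finite R M] (hI : I.IsInvertible) {Q w : ℕ} (hQ : 1 < Q)
    (hS : ∀ (S : Type u) [AddCommGroup S] [Module R S] [IsSimpleModule R S],
      Nat.card S = Q ∧ Nat.card (M →ₗ[R] S) = w)
    (hfin : ∀ k, {X : Submodule R M | Nat.card (M ⧸ X) = Q ^ k}.Finite)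
    {K : Submodule R M} (hK : K = I • ⊤)
    (hfinK : ∀ k, {L : Submodule R (M ⧸ K) | Nat.card ((M ⧸ K) ⧸ L) = Q ^ k}.Finite)
    (hiso : ∀ L : Submodule R (M ⧸ K), Finite ((M ⧸ K) ⧸ L) → Nonempty (L ≃ₗ[R] (M ⧸ K)))
    (k l : ℕ) :
    bigradedCount K Q (k + l) l = ∑ p ∈ Finset.HasAntidiagonal.antidiagonal l,
      indexCount R (M ⧸ K) Q p.1 * (w ^ p.2 * bigradedCount K Q k p.2) := by
  classical
  have hpow : ∀ n, Q ^ n ≠ 0 := fun n => by positivity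
  have hex : ∀ X : Submodule R M, ∃ X' : Submodule R M, I • X' = X ⊓ K := fun X =>
    hI.exists_smul_eq (hK ▸ inf_le_right)
  -- `d X` is the submodule `X'` attached to `X`.
  choose d hd using hex
  have hle : ∀ X, X ≤ d X := fun X => hI.le_of_smul_le (by
    rw [hd, hK]
    exact le_inf Submodule.smul_le_right (Submodule.smul_mono le_rfl le_top))
  have hcard : ∀ X X' : Submodule R M, Finite (M ⧸ X') → X ⊓ K = I • X' →
      Nat.card (M ⧸ X) = Nat.card (M ⧸ X') * Nat.card ((M ⧸ K) ⧸ X.map K.mkQ) := by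
    intro X X' _ h
    rw [Submodule.card_quotient_eq_mul K X, h, hK, hI.relIndex_smul (fun S => (hS S).1) hQ X']
  have hfd : ∀ X, Finite (M ⧸ X) → Finite (M ⧸ d X) := fun X _ =>
    Finite.of_surjective _ (Submodule.factor_surjective (hle X))
  have hbfin : {X : Submodule R M | Nat.card (M ⧸ X) = Q ^ (k + l) ∧
      Nat.card ((M ⧸ K) ⧸ X.map K.mkQ) = Q ^ l}.Finite := (hfin (k + l)).subset fun X h => h.1
  let ll : Submodule R M → ℕ := fun X => Nat.log Q (Nat.card ((M ⧸ K) ⧸ X.map K.mkQ))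
  let T := (hfin k).toFinset
  let U := (hfinK l).toFinset
  have hT : ∀ X, X ∈ T ↔ Nat.card (M ⧸ X) = Q ^ k := fun X => Set.Finite.mem_toFinset _
  have hU : ∀ L, L ∈ U ↔ Nat.card ((M ⧸ K) ⧸ L) = Q ^ l := fun X => Set.Finite.mem_toFinset _
  have hTll : ∀ X ∈ T, Nat.card ((M ⧸ K) ⧸ X.map K.mkQ) = Q ^ ll X := fun X hX =>
    exists_log_card_quotient hQ hS K X (Nat.finite_of_card_ne_zero (by rw [(hT X).1 hX]; apply hpow))
  -- the number of submodules over a given pair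
  have hfib : ∀ X' ∈ T, ∀ L ∈ U, (hbfin.toFinset.filter fun X => (d X, X.map K.mkQ) = (X', L)).card =
      if L ≤ X'.map K.mkQ then w ^ ll X' else 0 := by
    intro X' hX' L hL
    have hf' : Finite (M ⧸ X') := Nat.finite_of_card_ne_zero (by rw [(hT X').1 hX']; apply hpow)
    have hfL : Finite ((M ⧸ K) ⧸ L) := Nat.finite_of_card_ne_zero (by rw [(hU L).1 hL]; apply hpow)
    split_ifs with h
    · obtain ⟨e⟩ := hiso L hfL
      rw [← hI.card_fiber hQ hS hK e (hTll X' hX') h, ← Set.ncard_coe_finset]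
      congr 1
      ext X
      rw [Finset.mem_coe, Finset.mem_filter, Set.Finite.mem_toFinset]
      constructor
      · rintro ⟨-, h2⟩
        rw [Prod.mk.injEq] at h2
        exact ⟨by rw [← hd, h2.1], h2.2⟩
      · rintro ⟨h1, h2⟩
        refine ⟨⟨?_, ?_⟩, ?_⟩
        · rw [hcard X X' hf' h1, (hT X').1 hX', h2, (hU L).1 hL, pow_add]
        · rw [h2, (hU L).1 hL]
        · rw [h2, Prod.mk.injEq]
          refine ⟨?_, rfl⟩
          rw [← hd] at h1
          exact le_antisymm (hI.le_of_smul_le h1.le) (hI.le_of_smul_le h1.ge)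
    · rw [Finset.card_eq_zero, Finset.filter_eq_empty_iff]
      rintro X - h2
      rw [Prod.mk.injEq] at h2
      apply h
      rw [← h2.1, ← h2.2]
      exact Submodule.map_mono (hle X)
  have hmaps : ∀ X ∈ hbfin.toFinset, (d X, X.map K.mkQ) ∈ T ×ˢ U := by
    intro X hX
    rw [Set.Finite.mem_toFinset] at hX
    obtain ⟨h1, h2⟩ := hX
    have hf : Finite (M ⧸ X) := Nat.finite_of_card_ne_zero (by rw [h1]; apply hpow)
    rw [Finset.mem_product, hT, hU]
    refine ⟨?_, h2⟩
    have h3 := hcard X (d X) (hfd X hf) (hd X).symm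
    rw [h1, h2, pow_add] at h3
    exact (Nat.eq_of_mul_eq_mul_right (Nat.pos_of_ne_zero (hpow l)) h3).symm
  rw [bigradedCount, Set.ncard_eq_toFinset_card _ hbfin, Finset.card_eq_sum_card_fiberwise hmaps,
    Finset.sum_product]
  -- The fibre size does not depend on `L`, so it remains to count the `L` inside the image of `X'`,
  -- which is a copy of `M / K`.
  have hsum : ∀ X' ∈ T, ∑ L ∈ U,
      (hbfin.toFinset.filter fun X => (d X, X.map K.mkQ) = (X', L)).card =
      w ^ ll X' * if ll X' ≤ l then indexCount R (M ⧸ K) Q (l - ll X') else 0 := by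
    intro X' hX'
    have hfX : Finite ((M ⧸ K) ⧸ X'.map K.mkQ) :=
      Nat.finite_of_card_ne_zero (by rw [hTll X' hX']; apply hpow)
    obtain ⟨e⟩ := hiso _ hfX
    rw [Finset.sum_congr rfl (hfib X' hX'), ← Finset.sum_filter, Finset.sum_const, smul_eq_mul,
      mul_comm, ← ncard_le_of_isomorphic hQ (hTll X' hX') e, ← Set.ncard_coe_finset]
    congr 2
    ext L
    rw [Finset.mem_coe, Finset.mem_filter, hU]
    rfl
  rw [Finset.sum_congr rfl hsum]
  have hb : ∀ j, bigradedCount K Q k j = (T.filter fun X => ll X = j).card := by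
    intro j
    rw [bigradedCount, ← Set.ncard_coe_finset]
    congr 1
    ext X
    rw [Finset.mem_coe, Finset.mem_filter]
    constructor
    · rintro ⟨h1, h2⟩
      exact ⟨(hT X).2 h1, by simp only [ll]; rw [h2, Nat.log_pow hQ]⟩
    · rintro ⟨h1, rfl⟩
      exact ⟨(hT X).1 h1, hTll X h1⟩
  have hR : ∀ p : ℕ × ℕ, indexCount R (M ⧸ K) Q p.1 * (w ^ p.2 * bigradedCount K Q k p.2) =
      ∑ X ∈ T, if ll X = p.2 then w ^ p.2 * indexCount R (M ⧸ K) Q p.1 else 0 := by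
    intro p
    rw [hb, ← Finset.sum_filter, Finset.sum_const, smul_eq_mul]
    ring
  simp only [hR]
  rw [Finset.sum_comm]
  refine Finset.sum_congr rfl fun X hX => ?_
  split_ifs with h
  · rw [Finset.sum_eq_single (l - ll X, ll X)]
    · simp
    · rintro ⟨i, j⟩ hp hne
      rw [Finset.HasAntidiagonal.mem_antidiagonal] at hp
      simp only at hp ⊢
      rw [if_neg]
      rintro rfl
      exact hne (by rw [← hp, Nat.add_sub_cancel])
    · intro hn
      exact absurd (Finset.HasAntidiagonal.mem_antidiagonal.2 (Nat.sub_add_cancel h)) hn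
  · rw [mul_zero]
    symm
    refine Finset.sum_eq_zero fun p hp => ?_
    rw [Finset.HasAntidiagonal.mem_antidiagonal] at hp
    rw [if_neg]
    omega

end Recursion

/-! ### Submodules of finite index and the Jacobson radical -/

section Jacobson

variable {R : Type u} [Ring R] {M : Type v} [AddCommGroup M] [Module R M]

theorem Submodule.exists_isCoatom_ge (X : Submodule R M) [Finite (M ⧸ X)] (hX : X ≠ ⊤) :
    ∃ H : Submodule R M, IsCoatom H ∧ X ≤ H := by
  have hfin : (Set.Ici X \ {⊤}).Finite := X.finite_Ici.subset Set.sdiff_subset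
  obtain ⟨H, hH⟩ := hfin.exists_maximal ⟨X, le_refl X, hX⟩
  refine ⟨H, ⟨hH.1.2, fun Y hY => ?_⟩, hH.1.1⟩
  by_contra hY'
  exact hY.not_ge (hH.2 ⟨le_trans hH.1.1 hY.le, hY'⟩ hY.le)

theorem IsCoatom.jacobson_smul_top_le {H : Submodule R M} (hH : IsCoatom H) :
    Ring.jacobson R • (⊤ : Submodule R M) ≤ H :=
  (Ring.jacobson_smul_top_le R M).trans (sInf_le hH)

/-- Nakayama's lemma without finite generation: a proper submodule of finite index lies in a maximal
one, which also contains `JM`. -/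
theorem Submodule.eq_top_of_sup_eq_top (X : Submodule R M) [Finite (M ⧸ X)] {K : Submodule R M}
    (hK : K ≤ Ring.jacobson R • ⊤) (h : X ⊔ K = ⊤) : X = ⊤ := by
  by_contra hX
  obtain ⟨H, hH, hXH⟩ := X.exists_isCoatom_ge hX
  exact hH.1 (top_le_iff.1 (h ▸ sup_le hXH (hK.trans hH.jacobson_smul_top_le)))

theorem finite_quotient_smul_top [Module.Finite R M] (J : Ideal R) [Finite (R ⧸ J)] :
    Finite (M ⧸ (J • ⊤ : Submodule R M)) := by
  obtain ⟨n, s, hs⟩ := Module.Finite.exists_fin (R := R) (M := M)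
  let F : (Fin n → R ⧸ J) → M ⧸ (J • ⊤ : Submodule R M) := fun c =>
    Submodule.mkQ _ (∑ i, (c i).out • s i)
  refine Finite.of_surjective F fun y => ?_
  obtain ⟨x, rfl⟩ := Submodule.mkQ_surjective _ y
  have hx : x ∈ Submodule.span R (Set.range s) := hs ▸ Submodule.mem_top
  obtain ⟨c, rfl⟩ := (Submodule.mem_span_range_iff_exists_fun R).1 hx
  refine ⟨fun i => Submodule.mkQ J (c i), ?_⟩
  change Submodule.mkQ _ _ = Submodule.mkQ _ _
  rw [← sub_eq_zero, ← map_sub, ← Finset.sum_sub_distrib, Submodule.mkQ_apply,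
    Submodule.Quotient.mk_eq_zero]
  refine Submodule.sum_mem _ fun i _ => ?_
  rw [← sub_smul]
  refine Submodule.smul_mem_smul ?_ Submodule.mem_top
  rw [← Submodule.Quotient.eq]
  exact Quotient.out_eq' _

theorem Submodule.FG.smul_top [Module.Finite R M] {J : Ideal R} [J.IsTwoSided] (hJ : J.FG) :
    (J • ⊤ : Submodule R M).FG := by
  obtain ⟨n, s, hs⟩ := Module.Finite.exists_fin (R := R) (M := M)
  have h : (J • ⊤ : Submodule R M) = ⨆ i, Submodule.map (LinearMap.toSpanSingleton R M (s i)) J := by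
    apply le_antisymm
    · refine Submodule.smul_le.2 fun a ha x _ => ?_
      have hx : x ∈ Submodule.span R (Set.range s) := hs ▸ Submodule.mem_top
      obtain ⟨c, rfl⟩ := (Submodule.mem_span_range_iff_exists_fun R).1 hx
      rw [Finset.smul_sum]
      refine Submodule.sum_mem _ fun i _ => Submodule.mem_iSup_of_mem i ?_
      rw [smul_smul]
      exact ⟨a * c i, J.mul_mem_right _ ha, rfl⟩
    · refine iSup_le fun i => ?_
      rintro _ ⟨a, ha, rfl⟩
      exact Submodule.smul_mem_smul ha Submodule.mem_top
  rw [h]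
  exact Submodule.fg_iSup _ fun i => Submodule.FG.map _ hJ

theorem Submodule.fg_of_smul_top_le [Module.Finite R M] {J : Ideal R} [J.IsTwoSided]
    [Finite (R ⧸ J)] (hJ : J.FG) {H : Submodule R M} (hH : J • ⊤ ≤ H) : H.FG := by
  have h1 : (J • ⊤ : Submodule R M).FG := Submodule.FG.smul_top hJ
  have h2 := finite_quotient_smul_top (M := M) J
  refine Submodule.fg_of_fg_map_of_fg_inf_ker (J • ⊤ : Submodule R M).mkQ ?_ ?_
  · have : Finite (H.map (J • ⊤ : Submodule R M).mkQ) := inferInstance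
    exact Module.Finite.iff_fg.1 inferInstance
  · rwa [Submodule.ker_mkQ, inf_eq_right.2 hH]

/-- A proper `X` of finite index lies in a maximal `H ⊇ JM`. There are finitely many such `H` since
`M / JM` is finite, each is finitely generated since `J` is, and `X` has smaller index in `H`; so
induction applies with `H` in place of `M`. -/
theorem finite_setOf_card_quotient_eq [Finite (R ⧸ Ring.jacobson R)] (hJ : (Ring.jacobson R).FG)
    {n : ℕ} (hn : 0 < n) (M : Type v) [AddCommGroup M] [Module R M] [Module.Finite R M] :
    {X : Submodule R M | Nat.card (M ⧸ X) = n}.Finite := by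
  induction n using Nat.strong_induction_on generalizing M with
  | _ n ih =>
  have h2 := finite_quotient_smul_top (M := M) (Ring.jacobson R)
  have hfin := (Ring.jacobson R • ⊤ : Submodule R M).finite_Ici
  have hsub : {X : Submodule R M | Nat.card (M ⧸ X) = n} ⊆ {⊤} ∪
      ⋃ H ∈ {H ∈ Set.Ici (Ring.jacobson R • ⊤ : Submodule R M) | H ≠ ⊤}, ⋃ k ∈ Finset.range n,
        Submodule.map H.subtype '' {X : Submodule R H | 0 < k ∧ Nat.card (H ⧸ X) = k} := by
    intro X hX
    have hX' : Nat.card (M ⧸ X) = n := hX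
    have : Finite (M ⧸ X) := Nat.finite_of_card_ne_zero (by omega)
    by_cases htop : X = ⊤
    · exact Or.inl htop
    right
    obtain ⟨H, hH, hXH⟩ := X.exists_isCoatom_ge htop
    have h1 := Submodule.card_quotient_map_of_injective H.injective_subtype (X.comap H.subtype)
    rw [Submodule.map_comap_subtype, inf_eq_right.2 hXH, Submodule.range_subtype, hX'] at h1
    have hH1 : Nat.card (M ⧸ H) ≠ 1 := fun h => hH.1 (Submodule.card_quotient_eq_one_iff.1 h)
    have hk0 : Nat.card (H ⧸ X.comap H.subtype) ≠ 0 := fun h => by rw [h, zero_mul] at h1; omega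
    have hH0 : Nat.card (M ⧸ H) ≠ 0 := fun h => by rw [h, mul_zero] at h1; omega
    simp only [Set.mem_iUnion]
    refine ⟨H, ⟨hH.jacobson_smul_top_le, hH.1⟩, Nat.card (H ⧸ X.comap H.subtype), ?_,
      X.comap H.subtype, ⟨Nat.pos_of_ne_zero hk0, rfl⟩, ?_⟩
    · rw [Finset.mem_range, h1]
      exact lt_mul_of_one_lt_right (Nat.pos_of_ne_zero hk0) (by omega)
    · rw [Submodule.map_comap_subtype, inf_eq_right.2 hXH]
  refine Set.Finite.subset (Set.Finite.union (Set.finite_singleton _) ?_) hsub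
  refine Set.Finite.biUnion (hfin.subset fun H h => h.1) fun H hH => ?_
  refine Set.Finite.biUnion (Finset.finite_toSet _) fun k hk => Set.Finite.image _ ?_
  -- `Nat.card` is zero for infinite quotients; the condition `0 < k` in the covering family makes
  -- this case empty.
  rcases Nat.eq_zero_or_pos k with rfl | hk0
  · simp
  have : Module.Finite R H := Module.Finite.iff_fg.2 (Submodule.fg_of_smul_top_le hJ hH.1)
  exact (ih k (by simpa using hk) hk0 H).subset fun X h => h.2

end Jacobson

/-! ### The simple modules of a ring that is semisimple modulo its radical -/

section Wedderburn

variable {R : Type u} [Ring R] {ι : Type v} {F : ι → Type w} [∀ i, Field (F i)] {r : ι → ℕ}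

/-- The simple module of column vectors attached to a factor of a decomposition of `R / J` as a
product of matrix rings. -/
def WedderburnModule
    (_e : (R ⧸ Ring.jacobson R) ≃+* ((i : ι) → Matrix (Fin (r i)) (Fin (r i)) (F i))) (i : ι) :
    Type w :=
  Fin (r i) → F i

namespace WedderburnModule

variable (e : (R ⧸ Ring.jacobson R) ≃+* ((i : ι) → Matrix (Fin (r i)) (Fin (r i)) (F i))) (i : ι)

instance : AddCommGroup (WedderburnModule e i) :=
  inferInstanceAs (AddCommGroup (Fin (r i) → F i))

/-- The action of `R` on column vectors. -/
def actionHom : R →+* Module.End (F i) (Fin (r i) → F i) :=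
  (Matrix.toLinAlgEquiv' (R := F i) (n := Fin (r i))).toRingEquiv.toRingHom.comp
    ((Pi.evalRingHom _ i).comp (e.toRingHom.comp (Ideal.Quotient.mk (Ring.jacobson R))))

instance : Module R (WedderburnModule e i) :=
  Module.compHom (Fin (r i) → F i) (actionHom e i)

theorem smul_eq (a : R) (x : WedderburnModule e i) :
    a • x = (e (Ideal.Quotient.mk (Ring.jacobson R) a) i).mulVec x := by
  change Matrix.toLinAlgEquiv' (e (Ideal.Quotient.mk (Ring.jacobson R) a) i)
    (x : Fin (r i) → F i) = _
  exact Matrix.toLinAlgEquiv'_apply _ _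

theorem exists_smul_eq (A : (i : ι) → Matrix (Fin (r i)) (Fin (r i)) (F i)) :
    ∃ a : R, ∀ (i : ι) (x : WedderburnModule e i), a • x = (A i).mulVec x := by
  obtain ⟨a, ha⟩ := Ideal.Quotient.mk_surjective (e.symm A)
  exact ⟨a, fun i x => by rw [smul_eq, ha, e.apply_symm_apply]⟩

variable {i}

theorem card_eq {q : ℕ} (hq : Nat.card (F i) = q) : Nat.card (WedderburnModule e i) = q ^ r i := by
  change Nat.card (Fin (r i) → F i) = _
  rw [Nat.card_pi, Finset.prod_const, hq, Finset.card_univ, Fintype.card_fin]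

theorem nontrivial (hr : 0 < r i) : Nontrivial (WedderburnModule e i) := by
  have : Nonempty (Fin (r i)) := ⟨⟨0, hr⟩⟩
  exact inferInstanceAs (Nontrivial (Fin (r i) → F i))

theorem isSimpleModule (hr : 0 < r i) : IsSimpleModule R (WedderburnModule e i) := by
  classical
  have := nontrivial e hr
  rw [isSimpleModule_iff_toSpanSingleton_surjective]
  refine ⟨this, fun x hx y => ?_⟩
  obtain ⟨k, hk⟩ : ∃ k, x k ≠ 0 := Function.ne_iff.1 hx
  -- The matrix with `k`-th column `(x k)⁻¹ y` and zeros elsewhere sends `x` to `y`.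
  obtain ⟨a, ha⟩ := exists_smul_eq e (Pi.single i
    (Matrix.of fun s t => if t = k then y s * (x k)⁻¹ else 0))
  refine ⟨a, ?_⟩
  rw [LinearMap.toSpanSingleton_apply, ha, Pi.single_eq_same]
  funext s
  simp [Matrix.mulVec, dotProduct, hk]

/-- The identity of the `i`-th block acts as `1` on the source and as `0` on the target. -/
theorem linearMap_eq_zero {j : ι} (hij : i ≠ j)
    (f : WedderburnModule e i →ₗ[R] WedderburnModule e j) : f = 0 := by
  classical
  obtain ⟨a, ha⟩ := exists_smul_eq e (Pi.single i 1)
  ext x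
  have h1 : a • x = x := by
    rw [ha, Pi.single_eq_same]
    exact Matrix.one_mulVec (x : Fin (r i) → F i)
  have h2 : a • f x = 0 := by
    rw [ha, Pi.single_eq_of_ne hij.symm]
    exact Matrix.zero_mulVec (f x : Fin (r j) → F j)
  rw [← h1, map_smul, h2]
  rfl

/-- Endomorphisms are scalars. The matrix with `k`-th column `y` maps every `x` to `x k` times `y`,
so it maps the basis vector `x₀` to `y`; commuting with it forces `f y` to be `f x₀ k` times `y`. -/
theorem card_end (hr : 0 < r i) {q : ℕ} (hq : Nat.card (F i) = q) :
    Nat.card (WedderburnModule e i →ₗ[R] WedderburnModule e i) = q := by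
  classical
  let k : Fin (r i) := ⟨0, hr⟩
  rw [← hq]
  symm
  let G : F i → (WedderburnModule e i →ₗ[R] WedderburnModule e i) := fun c =>
    { toFun := fun x s => c * x s
      map_add' := fun x y => by
        funext s
        exact mul_add c _ _
      map_smul' := fun a x => by
        refine Eq.trans ?_ (smul_eq e i a _).symm
        refine Eq.trans ?_ (Matrix.mulVec_smul _ c (x : Fin (r i) → F i)).symm
        rw [smul_eq]
        rfl }
  let x₀ : WedderburnModule e i := Pi.single k 1
  refine Nat.card_congr (Equiv.ofBijective G ⟨fun c c' h => ?_, fun f => ⟨f x₀ k, ?_⟩⟩)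
  · have := congrFun (LinearMap.congr_fun h x₀) k
    change c * (Pi.single k 1 : Fin (r i) → F i) k = c' * (Pi.single k 1 : Fin (r i) → F i) k at this
    simpa using this
  · ext y
    obtain ⟨a, ha⟩ := exists_smul_eq e (Pi.single i (Matrix.of fun s t => if t = k then y s else 0))
    have hax : ∀ x : WedderburnModule e i, a • x = fun s => x k * y s := fun x => by
      rw [ha, Pi.single_eq_same]
      funext s
      simp [Matrix.mulVec, dotProduct, mul_comm]
    have h1 : a • x₀ = y := by
      rw [hax]
      funext s
      change (Pi.single k 1 : Fin (r i) → F i) k * y s = y s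
      simp
    have h2 : f y = fun s => f x₀ k * y s := by rw [← hax, ← map_smul, h1]
    rw [h2]
    rfl

theorem card_linearMap (hr : ∀ i, 0 < r i) {q : ℕ} (hq : ∀ i, Nat.card (F i) = q) [DecidableEq ι]
    (i j : ι) :
    Nat.card (WedderburnModule e i →ₗ[R] WedderburnModule e j) = if i = j then q else 1 := by
  split_ifs with h
  · subst h
    exact card_end e (hr i) (hq i)
  · rw [Nat.card_eq_one_iff_unique]
    exact ⟨⟨fun f g => (linearMap_eq_zero e h f).trans (linearMap_eq_zero e h g).symm⟩, ⟨0⟩⟩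

/-- The embedding of column vectors as the `j`-th column of the `i`-th matrix ring. -/
def toColumn [DecidableEq ι] (i : ι) (j : Fin (r i)) :
    WedderburnModule e i →ₗ[R] R ⧸ Ring.jacobson R where
  toFun x := e.symm (Pi.single i (Matrix.of fun s t => if t = j then x s else 0))
  map_add' x y := by
    rw [← map_add, ← Pi.single_add]
    congr 2
    ext s t
    change (if t = j then x s + y s else 0) = (if t = j then x s else 0) + (if t = j then y s else 0)
    split_ifs <;> simp
  map_smul' a x := by
    have h : a • e.symm (Pi.single i (Matrix.of fun s t => if t = j then x s else 0)) =
        Ideal.Quotient.mk (Ring.jacobson R) a *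
          e.symm (Pi.single i (Matrix.of fun s t => if t = j then x s else 0)) := rfl
    rw [RingHom.id_apply, h, RingEquiv.symm_apply_eq, map_mul, e.apply_symm_apply, smul_eq]
    funext i'
    by_cases hi : i' = i
    · subst hi
      rw [Pi.single_eq_same, Pi.mul_apply, Pi.single_eq_same]
      ext s t
      rw [Matrix.mul_apply]
      simp only [Matrix.of_apply, Matrix.mulVec, dotProduct]
      split_ifs <;> simp
    · rw [Pi.single_eq_of_ne hi, Pi.mul_apply, Pi.single_eq_of_ne hi, mul_zero]

/-- `J` annihilates `S`, so `S` is a quotient of `R / J`, which is spanned by columns. Some column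
maps nontrivially to `S`, and Schur's lemma makes that map an isomorphism. -/
theorem exists_equiv [Fintype ι] (hr : ∀ i, 0 < r i) (S : Type*) [AddCommGroup S] [Module R S]
    [IsSimpleModule R S] : ∃ i, Nonempty (S ≃ₗ[R] WedderburnModule e i) := by
  classical
  have hS := IsSimpleModule.nontrivial R S
  obtain ⟨x, hx⟩ := exists_ne (0 : S)
  have hJ : Ring.jacobson R ≤ LinearMap.ker (LinearMap.toSpanSingleton R S x) := fun a ha => by
    have h1 := (isCoatom_bot : IsCoatom (⊥ : Submodule R S)).jacobson_smul_top_le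
      (Submodule.smul_mem_smul ha (Submodule.mem_top (x := x)))
    exact h1
  let L : R ⧸ Ring.jacobson R →ₗ[R] S := (Ring.jacobson R).liftQ _ hJ
  by_cases h : ∃ (i : ι) (j : Fin (r i)), L ∘ₗ toColumn e i j ≠ 0
  · obtain ⟨i, j, hij⟩ := h
    have := isSimpleModule e (hr i)
    exact ⟨i, ⟨(LinearEquiv.ofBijective _ (LinearMap.bijective_of_ne_zero hij)).symm⟩⟩
  · exfalso
    push Not at h
    have h1 : (1 : R ⧸ Ring.jacobson R) =
        ∑ i, ∑ j, toColumn e i j (Pi.single j 1 : Fin (r i) → F i) := by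
      apply e.injective
      rw [map_one, map_sum]
      funext i
      rw [Finset.sum_apply, Finset.sum_eq_single i]
      · rw [map_sum, Finset.sum_apply]
        ext s t
        rw [Matrix.sum_apply, Finset.sum_eq_single t]
        · simp [toColumn, Matrix.one_apply, Pi.single_apply]
        · intro j _ hj
          simp [toColumn, hj.symm]
        · simp
      · intro i' _ hi
        rw [map_sum, Finset.sum_apply]
        refine Finset.sum_eq_zero fun j _ => ?_
        simp [toColumn, hi.symm]
      · simp
    have h2 : L 1 = x := by
      change LinearMap.toSpanSingleton R S x 1 = x
      simp
    apply hx
    rw [← h2, h1, map_sum]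
    refine Finset.sum_eq_zero fun i _ => ?_
    rw [map_sum]
    exact Finset.sum_eq_zero fun j _ => LinearMap.congr_fun (h i j) _

theorem card_simpleModuleClass [Fintype ι]
    (e : (R ⧸ Ring.jacobson R) ≃+* ((i : ι) → Matrix (Fin (r i)) (Fin (r i)) (F i)))
    (hr : ∀ i, 0 < r i) :
    Nat.card (SimpleModuleClass R) = Fintype.card ι := by
  classical
  -- The column modules live in the universe of `F`; quotients of `R` by maximal left ideals
  -- represent them in that of `R`.
  have hex : ∀ i, ∃ S : {S : ModuleCat.{u} R // IsSimpleModule R S},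
      Nonempty (WedderburnModule e i ≃ₗ[R] S.1) := fun i => by
    have := isSimpleModule e (hr i)
    obtain ⟨m, hm, ⟨E⟩⟩ := isSimpleModule_iff_quot_maximal.1 (isSimpleModule e (hr i))
    exact ⟨⟨ModuleCat.of R (R ⧸ m), IsSimpleModule.congr E.symm⟩, ⟨E⟩⟩
  choose S hS using hex
  let G : ι → SimpleModuleClass R := fun i => Quotient.mk (simpleModuleSetoid R) (S i)
  rw [← Nat.card_eq_fintype_card]
  symm
  refine Nat.card_congr (Equiv.ofBijective G ⟨fun i j h => ?_, fun c => ?_⟩)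
  · obtain ⟨E⟩ : Nonempty ((S i).1 ≃ₗ[R] (S j).1) := Quotient.exact h
    obtain ⟨Ei⟩ := hS i
    obtain ⟨Ej⟩ := hS j
    by_contra hij
    have h0 := linearMap_eq_zero e hij ((Ei.trans E).trans Ej.symm).toLinearMap
    have := nontrivial e (hr i)
    obtain ⟨x, hx⟩ := exists_ne (0 : WedderburnModule e i)
    exact hx (((Ei.trans E).trans Ej.symm).map_eq_zero_iff.1 (LinearMap.congr_fun h0 x))
  · induction c using Quotient.inductionOn with
    | h T =>
    have := T.2
    obtain ⟨i, ⟨E⟩⟩ := exists_equiv e hr T.1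
    obtain ⟨Ei⟩ := hS i
    exact ⟨i, Quotient.sound ⟨Ei.symm.trans E.symm⟩⟩

end WedderburnModule

end Wedderburn

/-! ### The zeta function of a projective module -/

theorem solomonZeta_apply (R : Type u) (M : Type v) [Ring R] [AddCommGroup M] [Module R M] {n : ℕ}
    (hn : n ≠ 0) :
    solomonZeta R M n = ({X : Submodule R M | Nat.card (M ⧸ X) = n}.ncard : ℂ) :=
  if_neg hn

theorem solomonZeta_of_subsingleton (R : Type u) (M : Type v) [Ring R] [AddCommGroup M] [Module R M]
    [Subsingleton M] : solomonZeta R M = 1 := by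
  ext n
  rcases eq_or_ne n 0 with rfl | hn
  · simp
  rw [solomonZeta_apply R M hn, ArithmeticFunction.one_apply]
  have h : ∀ X : Submodule R M, Nat.card (M ⧸ X) = 1 := fun X =>
    Submodule.card_quotient_eq_one_iff.2 (Subsingleton.elim _ _)
  simp only [h]
  split_ifs with h1
  · subst h1
    simp [Set.ncard_univ]
  · simp [Ne.symm h1]

section ProjectiveModule

variable {R : Type u} [Ring R] {M : Type u} [AddCommGroup M] [Module R M]

/-- `J` kills `S`, so `Hom(M, S) = Hom(M / JM, S)`. Only the `m` summands isomorphic to `S`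
contribute, each a factor `q`. -/
theorem card_linearMap_of_simple {ι : Type v} [Fintype ι] {F : ι → Type w} [∀ i, Field (F i)]
    {r' m' : ι → ℕ} (hr : ∀ i, 0 < r' i)
    (e : (R ⧸ Ring.jacobson R) ≃+* ((i : ι) → Matrix (Fin (r' i)) (Fin (r' i)) (F i)))
    {q m : ℕ} (hq : ∀ i, Nat.card (F i) = q) (hm : ∀ i, m' i = m)
    (g : M →ₗ[R] ((a : (i : ι) × Fin (m' i)) → WedderburnModule e a.1)) (hg : Function.Surjective g)
    (hker : LinearMap.ker g = Ring.jacobson R • ⊤)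
    (S : Type*) [AddCommGroup S] [Module R S] [IsSimpleModule R S] :
    Nat.card (M →ₗ[R] S) = q ^ m := by
  classical
  obtain ⟨i, ⟨E⟩⟩ := WedderburnModule.exists_equiv e hr S
  have h1 : Nat.card (((a : (i : ι) × Fin (m' i)) → WedderburnModule e a.1) →ₗ[R] S) =
      Nat.card (M →ₗ[R] S) := by
    refine Nat.card_congr (Equiv.ofBijective (fun φ => φ ∘ₗ g) ⟨fun φ ψ h => ?_, fun φ => ?_⟩)
    · refine LinearMap.ext fun x => ?_
      obtain ⟨y, rfl⟩ := hg x
      exact LinearMap.congr_fun h y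
    · have hle : LinearMap.ker g ≤ LinearMap.ker φ := by
        rw [hker, Submodule.smul_le]
        intro a ha x _
        have := (isCoatom_bot : IsCoatom (⊥ : Submodule R S)).jacobson_smul_top_le
          (Submodule.smul_mem_smul ha (Submodule.mem_top (x := φ x)))
        rw [LinearMap.mem_ker, map_smul]
        exact this
      refine ⟨(LinearMap.ker g).liftQ φ hle ∘ₗ (g.quotKerEquivOfSurjective hg).symm.toLinearMap, ?_⟩
      ext x
      have : (g.quotKerEquivOfSurjective hg).symm (g x) = Submodule.Quotient.mk x := by
        rw [LinearEquiv.symm_apply_eq]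
        rfl
      simp [this]
  have h2 : Nat.card (((a : (i : ι) × Fin (m' i)) → WedderburnModule e a.1) →ₗ[R] S) =
      Nat.card (((a : (i : ι) × Fin (m' i)) → WedderburnModule e a.1) →ₗ[R] WedderburnModule e i) :=
    Nat.card_congr
      { toFun := fun φ => E.toLinearMap ∘ₗ φ
        invFun := fun φ => E.symm.toLinearMap ∘ₗ φ
        left_inv := fun φ => LinearMap.ext fun x => E.symm_apply_apply (φ x)
        right_inv := fun φ => LinearMap.ext fun x => E.apply_symm_apply (φ x) }
  rw [← h1, h2, card_pi_linearMap, finprod_eq_prod_of_fintype, Fintype.prod_sigma]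
  simp only [WedderburnModule.card_linearMap e hr hq, Finset.prod_const, Finset.card_univ,
    Fintype.card_fin, hm]
  rw [Finset.prod_eq_single i] <;> simp +contextual

theorem hasFormalProd_solomonZeta {ι : Type v} [Fintype ι] {F : ι → Type w} [∀ i, Field (F i)]
    {r' m' : ι → ℕ} [Finite (R ⧸ Ring.jacobson R)] (hJ : (Ring.jacobson R).FG)
    [Module.Finite R M] [Module.Projective R M]
    {I : Ideal R} [I.IsTwoSided] (hI : I.IsInvertible) (hIJ : I ≤ Ring.jacobson R)
    (hiso : ∀ X Y : Submodule R (M ⧸ (I • ⊤ : Submodule R M)),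
        IsFiniteLength R ((M ⧸ (I • ⊤ : Submodule R M)) ⧸ X) →
        IsFiniteLength R ((M ⧸ (I • ⊤ : Submodule R M)) ⧸ Y) → Nonempty (X ≃ₗ[R] Y))
    (hr' : ∀ i, 0 < r' i)
    (e : (R ⧸ Ring.jacobson R) ≃+* ((i : ι) → Matrix (Fin (r' i)) (Fin (r' i)) (F i)))
    (f : (M ⧸ (Ring.jacobson R • ⊤ : Submodule R M)) ≃+
        ((i : ι) → Fin (m' i) → Fin (r' i) → F i))
    (hf : ∀ (a : R) (x : M ⧸ (Ring.jacobson R • ⊤ : Submodule R M)) (i : ι) (k : Fin (m' i)),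
        f (a • x) i k = (e (Ideal.Quotient.mk (Ring.jacobson R) a) i).mulVec (f x i k))
    {q r m : ℕ} (hq : ∀ i, Nat.card (F i) = q) (hr : ∀ i, r' i = r) (hm : ∀ i, m' i = m) :
    HasFormalProd
      (fun n => ∏ j ∈ Finset.range m,
        Ring.inverse (1 - dirichletMonomial ((q : ℂ) ^ (j + m * n)) (q ^ (r * (n + 1)))) ^
          Nat.card (SimpleModuleClass R))
      (solomonZeta R M) := by
  classical
  rw [WedderburnModule.card_simpleModuleClass e hr']
  -- Without simple modules the numbers `q`, `r`, `m` are unconstrained, but then `R = 0` and both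
  -- sides are `1`.
  rcases isEmpty_or_nonempty ι with hι | ⟨⟨i₀⟩⟩
  · have h1 : Subsingleton (R ⧸ Ring.jacobson R) := e.injective.subsingleton
    have h2 : Ring.jacobson R = ⊤ := Ideal.Quotient.subsingleton_iff.1 h1
    have h3 : Subsingleton R := by
      by_contra h
      rw [not_subsingleton_iff_nontrivial] at h
      exact (Ring.jacobson_lt_top R).ne h2
    have h4 : Subsingleton M := Module.subsingleton R M
    rw [solomonZeta_of_subsingleton]
    intro N
    exact ⟨0, fun k _ n _ => by simp⟩
  have hFfin : Finite (F i₀) := by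
    have h1 : Finite ((i : ι) → Matrix (Fin (r' i)) (Fin (r' i)) (F i)) := Finite.of_equiv _ e.toEquiv
    exact Finite.of_surjective
      (fun A : (i : ι) → Matrix (Fin (r' i)) (Fin (r' i)) (F i) => A i₀ ⟨0, hr' i₀⟩ ⟨0, hr' i₀⟩)
      fun x => ⟨fun i => Matrix.of fun _ _ => if h : i₀ = i then h ▸ x else 0, by simp⟩
  have hq1 : 1 < q := hq i₀ ▸ Finite.one_lt_card
  have hQ : 1 < q ^ r := Nat.one_lt_pow (by have := hr' i₀; rw [hr] at this; omega) hq1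
  let K : Submodule R M := I • ⊤
  have hKJ : K ≤ Ring.jacobson R • ⊤ := Submodule.smul_mono hIJ le_rfl
  let g₀ : M →ₗ[R] ((a : (i : ι) × Fin (m' i)) → WedderburnModule e a.1) :=
    { toFun := fun x a => f (Submodule.mkQ _ x) a.1 a.2
      map_add' := fun x y => by
        funext a
        rw [map_add, map_add]
        rfl
      map_smul' := fun c x => by
        funext a
        rw [map_smul]
        exact (hf c _ a.1 a.2).trans (WedderburnModule.smul_eq e a.1 c _).symm }
  have hg₀ : Function.Surjective g₀ := fun y => by
    let y' : (i : ι) → Fin (m' i) → Fin (r' i) → F i := fun i k => y ⟨i, k⟩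
    obtain ⟨x, hx⟩ := Submodule.mkQ_surjective _ (f.symm y')
    refine ⟨x, ?_⟩
    funext a
    change f (Submodule.mkQ _ x) a.1 a.2 = y' a.1 a.2
    rw [hx, f.apply_symm_apply]
  have hker₀ : LinearMap.ker g₀ = Ring.jacobson R • ⊤ := by
    ext x
    rw [LinearMap.mem_ker, ← Submodule.Quotient.mk_eq_zero (Ring.jacobson R • ⊤), ← f.map_eq_zero_iff]
    constructor
    · intro h
      funext i k
      exact congrFun h ⟨i, k⟩
    · intro h
      funext a
      exact congrFun (congrFun h a.1) a.2
  let g : M ⧸ K →ₗ[R] ((a : (i : ι) × Fin (m' i)) → WedderburnModule e a.1) :=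
    K.liftQ g₀ (hker₀ ▸ hKJ)
  have hg : Function.Surjective g := fun y => by
    obtain ⟨x, hx⟩ := hg₀ y
    exact ⟨K.mkQ x, hx⟩
  have hgker : LinearMap.ker g ≤ Ring.jacobson R • ⊤ := by
    intro y hy
    obtain ⟨x, rfl⟩ := K.mkQ_surjective y
    have hx : x ∈ LinearMap.ker g₀ := hy
    rw [hker₀] at hx
    have : K.mkQ x ∈ (Ring.jacobson R • ⊤ : Submodule R M).map K.mkQ := ⟨x, hx, rfl⟩
    rwa [Submodule.map_smul'', Submodule.map_top, Submodule.range_mkQ] at this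
  have hisoK : ∀ L : Submodule R (M ⧸ K), Finite ((M ⧸ K) ⧸ L) → Nonempty (L ≃ₗ[R] (M ⧸ K)) := by
    intro L hL
    -- The whole module has colength zero, so it belongs to the common isomorphism class.
    obtain ⟨E⟩ := hiso L ⊤
      (isFiniteLength_iff_isNoetherian_isArtinian.2 ⟨inferInstance, inferInstance⟩)
      (IsFiniteLength.of_subsingleton)
    exact ⟨E.trans Submodule.topEquiv⟩
  have hsimple := fun i => WedderburnModule.isSimpleModule e (hr' i)
  have hWcard : ∀ i, Nat.card (WedderburnModule e i) = q ^ r := fun i => by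
    rw [WedderburnModule.card_eq e (hq i), hr]
  have hS : ∀ (S : Type u) [AddCommGroup S] [Module R S] [IsSimpleModule R S],
      Nat.card S = q ^ r ∧ Nat.card (M →ₗ[R] S) = q ^ m := by
    intro S _ _ _
    refine ⟨?_, card_linearMap_of_simple hr' e hq hm g₀ hg₀ hker₀ S⟩
    obtain ⟨i, ⟨E⟩⟩ := WedderburnModule.exists_equiv e hr' S
    rw [Nat.card_congr E.toEquiv, hWcard]
  have hfin : ∀ k, {X : Submodule R M | Nat.card (M ⧸ X) = (q ^ r) ^ k}.Finite := fun k =>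
    finite_setOf_card_quotient_eq hJ (by positivity) M
  have hfinK : ∀ k, {L : Submodule R (M ⧸ K) | Nat.card ((M ⧸ K) ⧸ L) = (q ^ r) ^ k}.Finite :=
    fun k => finite_setOf_card_quotient_eq hJ (by positivity) (M ⧸ K)
  refine hasFormalProd_of_recursion (b := fun k l => (bigradedCount K (q ^ r) k l : ℂ))
    (c := fun j => (indexCount R (M ⧸ K) (q ^ r) j : ℂ)) hQ
    (fun k l h => by rw [bigradedCount_of_lt hQ h, Nat.cast_zero])
    (fun k => ?_) (fun k l => ?_) ?_ _ (fun k => ?_) (fun n hn => ?_)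
  · rw [bigradedCount_zero hQ fun X _ hX => X.eq_top_of_sup_eq_top hKJ hX]
    split_ifs <;> simp
  · rw [hI.bigradedCount_add hQ hS hfin rfl hfinK hisoK]
    push_cast
    rfl
  · refine mk_card_submodules_mul (κ := (i : ι) × Fin (m' i)) Sigma.fst
      (fun a => WedderburnModule e a.1) hQ (fun a => hWcard a.1)
      (fun a b => WedderburnModule.card_linearMap e hr' hq a.1 b.1) hfinK hisoK g hg
      (fun X _ hX => ?_) fun i => ?_
    · rw [LinearMap.map_eq_top_iff (LinearMap.range_eq_top.2 hg)] at hX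
      exact X.eq_top_of_sup_eq_top hgker hX
    · rw [← hm i, ← Fintype.card_fin (m' i), ← Fintype.card_subtype]
      exact Fintype.card_congr (Equiv.sigmaSubtype i)
  · rw [solomonZeta_apply R M (by positivity), ← Nat.cast_sum,
      ← indexCount_eq_sum_bigradedCount hQ hS hfin K k]
    rfl
  · rcases eq_or_ne n 0 with rfl | hn0
    · simp
    rw [solomonZeta_apply R M hn0, Nat.cast_eq_zero]
    convert Set.ncard_empty (Submodule R M)
    rw [Set.eq_empty_iff_forall_notMem]
    intro X hX
    have hX' : Nat.card (M ⧸ X) = n := hX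
    have : Finite (M ⧸ X) := Nat.finite_of_card_ne_zero (by rwa [hX'])
    obtain ⟨k, hk, -⟩ := exists_card_eq_pow hS (M ⧸ X)
    exact hn k (hX'.symm.trans hk)

end ProjectiveModule

/-! ### Two-dimensional regular local rings -/

section PrincipalIdeal

variable {R : Type u} [CommRing R] [IsDomain R]

/-- Multiplication by `y` identifies `R` with `(y)` as bimodules, so `I ⊗ -` is isomorphic to the
identity functor. -/
theorem Ideal.isInvertible_span_singleton {y : R} (hy : y ≠ 0) :
    (Ideal.span {y} : Ideal R).IsInvertible := by
  let I : Ideal R := Ideal.span {y}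
  let y' : I := ⟨y, Ideal.mem_span_singleton_self y⟩
  let E : R ≃ₗ[R] I := LinearEquiv.toSpanNonzeroSingleton R R y hy
  have hE : ∀ r, E r = r • y' := fun r => rfl
  have hd : ∀ x a, E.symm (I.rightMul x a) = E.symm x * a := fun x a => by
    have h : I.rightMul x a = a • x := Subtype.ext (mul_comm _ _)
    rw [h, map_smul, smul_eq_mul, mul_comm]
  have hmul : ∀ (N : Type u) [AddCommGroup N] [Module R N] (r : R) (n : N),
      I.tmul (r • y') n = I.tmul y' (r • n) := fun N _ _ r n => by
    rw [← Ideal.tmul_rightMul]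
    congr 1
    exact Subtype.ext (mul_comm _ _)
  let j : (N : ModuleCat.{u} R) → (N ≃ₗ[R] I.tensorObj N) := fun N =>
    { toFun := fun n => I.tmul y' n
      map_add' := I.tmul_add y'
      map_smul' := fun r n => by
        rw [RingHom.id_apply, ← hmul]
        simp only [Ideal.tmul, ← map_smul, TensorProduct.smul_tmul']
      invFun := I.tensorLift E.symm.toLinearMap hd N
      left_inv := fun n => by
        rw [Ideal.tensorLift_tmul]
        have : E.symm y' = 1 := by rw [LinearEquiv.symm_apply_eq, hE, one_smul]
        change E.symm y' • n = n
        rw [this, one_smul]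
      right_inv := fun t => by
        refine I.tensorObj_induction t ?_ (fun s t hs ht => ?_) fun x n => ?_
        · rw [map_zero]
          exact I.tmul_zero y'
        · rw [map_add]
          exact (I.tmul_add y' _ _).trans (congrArg₂ _ hs ht)
        · rw [Ideal.tensorLift_tmul]
          refine (hmul N (E.symm x) n).symm.trans ?_
          congr 1
          exact E.apply_symm_apply x }
  have iso : CategoryTheory.Functor.id (ModuleCat.{u} R) ≅ I.tensorFunctor :=
    CategoryTheory.NatIso.ofComponents (fun N => (j N).toModuleIso) (by
      intro N N' φ
      apply ModuleCat.hom_ext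
      refine LinearMap.ext fun n => ?_
      exact (I.tensorMap_tmul φ.hom y' n).symm)
  exact CategoryTheory.Functor.isEquivalence_of_iso iso

end PrincipalIdeal

/-! ### Noetherian local rings with principal maximal ideal -/

section PrincipalMaximalIdeal

variable {A : Type*} [CommRing A] [IsNoetherianRing A] [IsLocalRing A]

/-- Krull's intersection theorem gives a largest power of the maximal ideal containing `z`; a
non-unit cofactor would put `z` in the next one. -/
theorem IsLocalRing.exists_eq_unit_mul_pow {t : A} (ht : maximalIdeal A = Ideal.span {t}) {z : A}
    (hz : z ≠ 0) : ∃ (n : ℕ) (c : A), IsUnit c ∧ z = c * t ^ n := by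
  classical
  have hK := Ideal.iInf_pow_eq_bot_of_isLocalRing (maximalIdeal A) (Ideal.IsPrime.ne_top inferInstance)
  have hex : ∃ n, z ∉ maximalIdeal A ^ n := by
    by_contra! h
    have : z ∈ ⨅ n, maximalIdeal A ^ n := by rwa [Submodule.mem_iInf]
    rw [hK] at this
    exact hz this
  have h0 : Nat.find hex ≠ 0 := fun h => by
    have := Nat.find_spec hex
    rw [h, pow_zero, Ideal.one_eq_top] at this
    exact this Submodule.mem_top
  obtain ⟨n, hn⟩ := Nat.exists_eq_succ_of_ne_zero h0
  have h1 : z ∈ maximalIdeal A ^ n := by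
    by_contra h
    have := Nat.find_min' hex h
    omega
  have h2 : z ∉ maximalIdeal A ^ (n + 1) := by
    have := Nat.find_spec hex
    rwa [hn] at this
  rw [ht, Ideal.span_singleton_pow, Ideal.mem_span_singleton'] at h1
  obtain ⟨c, rfl⟩ := h1
  refine ⟨n, c, ?_, rfl⟩
  by_contra hc
  apply h2
  rw [pow_succ']
  exact Ideal.mul_mem_mul ((mem_maximalIdeal c).2 hc)
    (Ideal.pow_mem_pow (ht ▸ Ideal.mem_span_singleton_self t) n)

theorem IsLocalRing.isDomain_of_maximalIdeal_eq_span {t : A}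
    (ht : maximalIdeal A = Ideal.span {t}) (hnil : ∀ n, t ^ n ≠ 0) : IsDomain A := by
  have : NoZeroDivisors A := ⟨fun {a b} hab => by
    by_contra! h
    obtain ⟨n, c, hc, rfl⟩ := exists_eq_unit_mul_pow ht h.1
    obtain ⟨m, d, hd, rfl⟩ := exists_eq_unit_mul_pow ht h.2
    have h1 : (c * d) * t ^ (n + m) = 0 := by rw [← hab]; ring
    exact hnil _ ((hc.mul hd).mul_right_eq_zero.1 h1)⟩
  exact NoZeroDivisors.to_isDomain A

end PrincipalMaximalIdeal

/-! ### Regular parameters and integrality in dimension two -/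

section RegularLocalRing

open IsLocalRing

variable {R : Type u} [CommRing R] [IsRegularLocalRing R]

theorem IsLocalRing.maximalIdeal_height_eq_two (hdim : ringKrullDim R = 2) :
    (maximalIdeal R).height = 2 :=
  WithBot.coe_injective ((maximalIdeal_height_eq_ringKrullDim (R := R)).trans hdim)

/-- Prime avoidance finds `y` in the maximal ideal outside its square and all minimal primes. Being
outside the square, `y` has a unit coefficient on one of two generators and can replace it. -/
theorem IsRegularLocalRing.exists_regular_parameters (hdim : ringKrullDim R = 2) :
    ∃ x y : R, maximalIdeal R = Ideal.span {x, y} ∧ ∀ P ∈ minimalPrimes R, y ∉ P := by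
  classical
  have hht := IsLocalRing.maximalIdeal_height_eq_two hdim
  have hrank : (maximalIdeal R).spanFinrank = 2 := by
    have := IsRegularLocalRing.spanFinrank_maximalIdeal (R := R)
    rw [hdim] at this
    exact_mod_cast this
  have hfg : (maximalIdeal R).FG := (maximalIdeal R).fg_of_isNoetherianRing
  obtain ⟨a, b, -, hab⟩ := Set.ncard_eq_two.1 ((Submodule.FG.generators_ncard hfg).trans hrank)
  have hm : maximalIdeal R = Ideal.span {a, b} := by
    rw [← hab]
    exact (Submodule.span_generators _).symm
  have hfin := minimalPrimes.finite_of_isNoetherianRing R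
  obtain ⟨y, hy, hy2, hyP⟩ : ∃ y ∈ maximalIdeal R, y ∉ maximalIdeal R ^ 2 ∧
      ∀ P ∈ minimalPrimes R, y ∉ P := by
    by_contra! h
    have hsub : (maximalIdeal R : Set R) ⊆ ⋃ i ∈ ((insert (maximalIdeal R ^ 2) hfin.toFinset :
        Finset (Ideal R)) : Set (Ideal R)), (i : Set R) := by
      intro y hy
      simp only [Set.mem_iUnion]
      by_cases hy2 : y ∈ maximalIdeal R ^ 2
      · exact ⟨maximalIdeal R ^ 2, by simp, hy2⟩
      · obtain ⟨P, hP, hyP⟩ := h y hy hy2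
        exact ⟨P, by simp [hP], hyP⟩
    have hprime : ∀ P ∈ insert (maximalIdeal R ^ 2) hfin.toFinset, P ≠ maximalIdeal R ^ 2 →
        P ≠ maximalIdeal R ^ 2 → (id P : Ideal R).IsPrime := by
      intro P hP hne _
      rw [Finset.mem_insert, Set.Finite.mem_toFinset] at hP
      exact (hP.resolve_left hne).1.1
    -- Prime avoidance tolerates up to two non-prime ideals; here the square of the maximal ideal
    -- fills both slots.
    obtain ⟨P, hP, hle⟩ := (Ideal.subset_union_prime _ _ hprime).1 hsub
    rw [Finset.mem_insert, Set.Finite.mem_toFinset] at hP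
    rcases hP with rfl | hP
    · have h0 : maximalIdeal R = ⊥ := by
        refine Submodule.eq_bot_of_le_smul_of_le_jacobson_bot (maximalIdeal R) _ hfg ?_
          (IsLocalRing.maximalIdeal_le_jacobson _)
        rw [smul_eq_mul, ← pow_two]
        exact hle
      rw [h0, Submodule.spanFinrank_bot] at hrank
      omega
    · have hPp : P.IsPrime := hP.1.1
      have hPm : P = maximalIdeal R := le_antisymm (le_maximalIdeal hPp.ne_top) hle
      have := Ideal.height_eq_zero_iff.2 hP
      rw [hPm, hht] at this
      exact absurd this (by norm_num)
  have key : ∀ a b c d : R, maximalIdeal R = Ideal.span {a, b} → y = c * a + d * b → IsUnit c →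
      maximalIdeal R = Ideal.span {b, y} := by
    intro a b c d hm hy' hc
    apply le_antisymm
    · rw [hm, Ideal.span_le, Set.pair_subset_iff]
      refine ⟨?_, Ideal.subset_span (by simp)⟩
      obtain ⟨c, rfl⟩ := hc
      have : a = ↑c⁻¹ * (y - d * b) := by rw [hy', add_sub_cancel_right, Units.inv_mul_cancel_left]
      rw [this]
      exact Ideal.mul_mem_left _ _ (sub_mem (Ideal.subset_span (by simp))
        (Ideal.mul_mem_left _ _ (Ideal.subset_span (by simp))))
    · rw [Ideal.span_le, Set.pair_subset_iff]
      exact ⟨hm ▸ Ideal.subset_span (by simp), hy⟩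
  have hy' := hy
  rw [hm, Ideal.mem_span_pair] at hy'
  obtain ⟨c, d, hcd⟩ := hy'
  by_cases hc : IsUnit c
  · exact ⟨b, y, key a b c d hm hcd.symm hc, hyP⟩
  by_cases hd : IsUnit d
  · exact ⟨a, y, key b a d c (by rw [hm, Set.pair_comm]) (by rw [← hcd, add_comm]) hd, hyP⟩
  exfalso
  apply hy2
  rw [← hcd, pow_two]
  have ha : a ∈ maximalIdeal R := hm ▸ Ideal.subset_span (by simp)
  have hb : b ∈ maximalIdeal R := hm ▸ Ideal.subset_span (by simp)
  exact add_mem (Ideal.mul_mem_mul ((mem_maximalIdeal c).2 hc) ha)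
    (Ideal.mul_mem_mul ((mem_maximalIdeal d).2 hd) hb)

/-- Otherwise the maximal ideal, of height two, would be minimal over `(y)`, against Krull's
principal ideal theorem. -/
theorem IsRegularLocalRing.pow_notMem_span (hdim : ringKrullDim R = 2) {x y : R}
    (hm : maximalIdeal R = Ideal.span {x, y}) (n : ℕ) : x ^ n ∉ Ideal.span {y} := by
  intro hx
  have hht := IsLocalRing.maximalIdeal_height_eq_two hdim
  have hmin : maximalIdeal R ∈ (Ideal.span {y}).minimalPrimes := by
    refine ⟨⟨inferInstance, ?_⟩, fun P hP _ => ?_⟩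
    · rw [hm]
      exact Ideal.span_mono (by simp)
    · have := hP.1
      rw [hm, Ideal.span_le, Set.pair_subset_iff]
      exact ⟨this.mem_of_pow_mem n (hP.2 hx), hP.2 (Ideal.mem_span_singleton_self y)⟩
  have : (Ideal.span {y} : Ideal R).IsPrincipal := ⟨⟨y, rfl⟩⟩
  have h1 := Ideal.height_le_one_of_isPrincipal_of_mem_minimalPrimes _ _ hmin
  rw [hht] at h1
  exact absurd h1 (by norm_num)

theorem IsLocalRing.maximalIdeal_quotient_eq_span {x y : R}
    (hm : maximalIdeal R = Ideal.span {x, y}) [IsLocalRing (R ⧸ Ideal.span {y})] :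
    maximalIdeal (R ⧸ Ideal.span {y}) = Ideal.span {Ideal.Quotient.mk (Ideal.span {y}) x} := by
  have hy : Ideal.span {y} ≠ (⊤ : Ideal R) := (Ideal.Quotient.nontrivial_iff).1 inferInstance
  have h1 := IsLocalRing.eq_maximalIdeal
    (Ideal.map_eq_top_or_isMaximal_of_surjective (Ideal.Quotient.mk (Ideal.span {y}))
      Ideal.Quotient.mk_surjective (maximalIdeal.isMaximal R) |>.resolve_left fun h => by
        have h2 := congrArg (Ideal.comap (Ideal.Quotient.mk (Ideal.span {y}))) h
        rw [Ideal.comap_map_of_surjective' _ Ideal.Quotient.mk_surjective, Ideal.mk_ker,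
          Ideal.comap_top, sup_eq_left.2 (le_maximalIdeal hy)] at h2
        exact Ideal.IsPrime.ne_top inferInstance h2)
  rw [← h1, hm, Ideal.map_span, Set.image_pair,
    Ideal.Quotient.eq_zero_iff_mem.2 (Ideal.mem_span_singleton_self y), Ideal.span_insert,
    Ideal.span_singleton_eq_bot.2 rfl, sup_bot_eq]

theorem IsLocalRing.isLocalRing_quotient_span {x y : R}
    (hm : maximalIdeal R = Ideal.span {x, y}) : IsLocalRing (R ⧸ Ideal.span {y}) := by
  have hy : Ideal.span {y} ≤ maximalIdeal R := hm ▸ Ideal.span_mono (by simp)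
  have : Nontrivial (R ⧸ Ideal.span {y}) := Ideal.Quotient.nontrivial_iff.2 fun h =>
    Ideal.IsPrime.ne_top (I := maximalIdeal R) inferInstance (top_le_iff.1 (h ▸ hy))
  exact IsLocalRing.of_surjective' (Ideal.Quotient.mk _) Ideal.Quotient.mk_surjective

theorem IsRegularLocalRing.exists_eq_unit_mul_pow {x y : R}
    (hm : maximalIdeal R = Ideal.span {x, y}) {z : R} (hz : z ∉ Ideal.span {y}) :
    ∃ (n : ℕ) (c : R), IsUnit c ∧ z - c * x ^ n ∈ Ideal.span {y} := by
  have := isLocalRing_quotient_span hm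
  obtain ⟨n, c, hc, h⟩ := IsLocalRing.exists_eq_unit_mul_pow (maximalIdeal_quotient_eq_span hm)
    (mt Ideal.Quotient.eq_zero_iff_mem.1 hz)
  obtain ⟨c, rfl⟩ := Ideal.Quotient.mk_surjective c
  refine ⟨n, c, ?_, ?_⟩
  · have : IsLocalHom (Ideal.Quotient.mk (Ideal.span {y} : Ideal R)) :=
      IsLocalHom.of_surjective _ Ideal.Quotient.mk_surjective
    exact isUnit_of_map_unit _ _ hc
  · rw [← Ideal.Quotient.eq_zero_iff_mem, map_sub, h, map_mul, map_pow, sub_self]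

theorem IsRegularLocalRing.span_isPrime (hdim : ringKrullDim R = 2) {x y : R}
    (hm : maximalIdeal R = Ideal.span {x, y}) : (Ideal.span {y}).IsPrime := by
  have := isLocalRing_quotient_span hm
  rw [← Ideal.Quotient.isDomain_iff_prime]
  refine isDomain_of_maximalIdeal_eq_span (maximalIdeal_quotient_eq_span hm) fun n hn => ?_
  rw [← map_pow] at hn
  exact pow_notMem_span hdim hm n (Ideal.Quotient.eq_zero_iff_mem.1 hn)

/-- A minimal prime `P` inside the prime `(y)` does not contain `y`, so `P = yP`, and Nakayama gives
`P = 0`. -/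
theorem IsRegularLocalRing.isDomain_of_notMem_minimalPrimes (hdim : ringKrullDim R = 2) {x y : R}
    (hm : maximalIdeal R = Ideal.span {x, y}) (hy : ∀ P ∈ minimalPrimes R, y ∉ P) :
    IsDomain R := by
  have hprime := span_isPrime hdim hm
  have hyJ : Ideal.span {y} ≤ maximalIdeal R := hm ▸ Ideal.span_mono (by simp)
  obtain ⟨P, hP, hle⟩ := Ideal.exists_minimalPrimes_le (bot_le : ⊥ ≤ Ideal.span {y})
  have hPp : P.IsPrime := hP.1.1
  have hbot : P = ⊥ := by
    refine Submodule.eq_bot_of_le_smul_of_le_jacobson_bot (Ideal.span {y}) P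
      P.fg_of_isNoetherianRing (fun p hp => ?_) (hyJ.trans (IsLocalRing.maximalIdeal_le_jacobson _))
    obtain ⟨a, rfl⟩ := Ideal.mem_span_singleton'.1 (hle hp)
    rw [mul_comm]
    exact Submodule.smul_mem_smul (Ideal.mem_span_singleton_self y)
      ((hPp.mem_or_mem hp).resolve_right (hy P hP))
  have : (⊥ : Ideal R).IsPrime := hbot ▸ hPp
  exact IsDomain.of_bot_isPrime R

end RegularLocalRing

/-! ### Submodules of `R / (y)` and Lustig's formula -/

section RegularLocalRing

open IsLocalRing

variable {R : Type u} [CommRing R] [IsRegularLocalRing R]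

/-- `X` is generated by the least power `x ^ n` it contains, and multiplication by `x ^ n` has
kernel exactly `(y)` because `(y)` is prime and misses `x ^ n`. -/
theorem IsRegularLocalRing.nonempty_linearEquiv_of_isFiniteLength (hdim : ringKrullDim R = 2)
    {x y : R} (hm : maximalIdeal R = Ideal.span {x, y})
    (X : Submodule R (R ⧸ (Ideal.span {y} • ⊤ : Submodule R R)))
    (hX : IsFiniteLength R ((R ⧸ (Ideal.span {y} • ⊤ : Submodule R R)) ⧸ X)) :
    Nonempty ((R ⧸ (Ideal.span {y} • ⊤ : Submodule R R)) ≃ₗ[R] X) := by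
  classical
  have hI : (Ideal.span {y} • ⊤ : Submodule R R) = Ideal.span {y} := by
    rw [smul_eq_mul, Ideal.mul_top]
  have hx : x ∈ maximalIdeal R := hm ▸ Ideal.subset_span (by simp)
  have hex : ∃ n, Submodule.mkQ (Ideal.span {y} • ⊤ : Submodule R R) (x ^ n) ∈ X := by
    have := (isFiniteLength_iff_isNoetherian_isArtinian.1 hX).2
    -- In the Artinian quotient by `X` one has `x ^ n = x ^ (n + 1) * c`, and `1 - x * c` is a unit,
    -- so `x ^ n` lies in `X`.
    obtain ⟨n, z, hz⟩ := IsArtinian.exists_pow_succ_smul_dvd x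
      (X.mkQ (Submodule.mkQ (Ideal.span {y} • ⊤ : Submodule R R) 1))
    obtain ⟨z, rfl⟩ := X.mkQ_surjective z
    obtain ⟨c, rfl⟩ := Submodule.mkQ_surjective _ z
    refine ⟨n, ?_⟩
    have hu : IsUnit (1 - x * c) := by
      have h1 : x * c ∈ maximalIdeal R := Ideal.mul_mem_right _ _ hx
      by_contra h
      have h2 := add_mem ((mem_maximalIdeal _).2 h) h1
      rw [sub_add_cancel] at h2
      exact (Ideal.ne_top_iff_one _).1 (Ideal.IsPrime.ne_top inferInstance) h2
    have h3 : (1 - x * c) • Submodule.mkQ (Ideal.span {y} • ⊤ : Submodule R R) (x ^ n) ∈ X := by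
      rw [← map_smul, ← map_smul, ← map_smul, ← map_smul, ← sub_eq_zero, ← map_sub, ← map_sub,
        Submodule.mkQ_apply, Submodule.Quotient.mk_eq_zero] at hz
      rw [← map_smul, ← neg_mem_iff, ← map_neg]
      convert hz using 2
      simp only [smul_eq_mul, Nat.succ_eq_add_one]
      ring
    obtain ⟨v, hv⟩ := hu
    have h4 := X.smul_mem (↑v⁻¹ : R) h3
    rwa [smul_smul, ← hv, Units.inv_mul, one_smul] at h4
  let n := Nat.find hex
  let φ : R →ₗ[R] X := LinearMap.toSpanSingleton R X ⟨_, Nat.find_spec hex⟩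
  have hφ : ∀ r, (φ r : R ⧸ (Ideal.span {y} • ⊤ : Submodule R R)) =
      Submodule.mkQ _ (r * x ^ n) := fun r => rfl
  have hker : LinearMap.ker φ = (Ideal.span {y} • ⊤ : Submodule R R) := by
    ext r
    rw [LinearMap.mem_ker, ← Submodule.coe_eq_zero, hφ, Submodule.mkQ_apply,
      Submodule.Quotient.mk_eq_zero, hI]
    have hp := span_isPrime hdim hm
    exact ⟨fun h => (hp.mem_or_mem h).resolve_right (pow_notMem_span hdim hm n),
      fun h => Ideal.mul_mem_right _ _ h⟩
  have hsurj : Function.Surjective φ := by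
    rintro ⟨z, hz⟩
    obtain ⟨z, rfl⟩ := Submodule.mkQ_surjective _ z
    by_cases hzy : z ∈ Ideal.span {y}
    · refine ⟨0, Subtype.ext ?_⟩
      rw [hφ, zero_mul, map_zero]
      exact ((Submodule.Quotient.mk_eq_zero _).2 (hI.ge hzy)).symm
    obtain ⟨l, c, ⟨v, rfl⟩, hl⟩ := exists_eq_unit_mul_pow hm hzy
    have h1 : Submodule.mkQ (Ideal.span {y} • ⊤ : Submodule R R) z = (v : R) •
        Submodule.mkQ (Ideal.span {y} • ⊤ : Submodule R R) (x ^ l) := by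
      rw [← sub_eq_zero, ← map_smul, ← map_sub]
      exact (Submodule.Quotient.mk_eq_zero _).2 (hI.ge hl)
    have h2 : Submodule.mkQ (Ideal.span {y} • ⊤ : Submodule R R) (x ^ l) ∈ X := by
      have h3 := X.smul_mem (↑v⁻¹ : R) hz
      rwa [h1, smul_smul, Units.inv_mul, one_smul] at h3
    obtain ⟨k, hk⟩ := Nat.exists_eq_add_of_le' (Nat.find_min' hex h2)
    refine ⟨v * x ^ k, Subtype.ext ?_⟩
    rw [hφ]
    change _ = Submodule.mkQ (Ideal.span {y} • ⊤ : Submodule R R) z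
    rw [h1, ← map_smul]
    refine congrArg _ ?_
    rw [hk, smul_eq_mul, pow_add, mul_assoc]
  exact ⟨(Submodule.quotEquivOfEq _ _ hker.symm).trans (φ.quotKerEquivOfSurjective hsurj)⟩

theorem IsRegularLocalRing.hasFormalProd_solomonZeta (hdim : ringKrullDim R = 2)
    [Finite (ResidueField R)] {q : ℕ} (hq : Nat.card (ResidueField R) = q) :
    FinitelyManyOfIndex R R ∧
      HasFormalProd
        (fun n => Ring.inverse (1 - dirichletMonomial ((q : ℂ) ^ n) (q ^ (n + 1))))
        (solomonZeta R R) := by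
  obtain ⟨x, y, hm, hy⟩ := exists_regular_parameters hdim
  have := isDomain_of_notMem_minimalPrimes hdim hm hy
  have hy0 : y ≠ 0 := by
    obtain ⟨P, hP, -⟩ := Ideal.exists_minimalPrimes_le (bot_le : ⊥ ≤ maximalIdeal R)
    rintro rfl
    exact hy P hP P.zero_mem
  have hJ : Ring.jacobson R = maximalIdeal R := ringJacobson_eq_maximalIdeal R
  have hJfg : (Ring.jacobson R).FG := Ideal.fg_of_isNoetherianRing _
  let E : (R ⧸ Ring.jacobson R) ≃+* ResidueField R := Ideal.quotEquivOfEq hJ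
  have : Finite (R ⧸ Ring.jacobson R) := Finite.of_equiv _ E.symm.toEquiv
  refine ⟨fun n hn => finite_setOf_card_quotient_eq hJfg hn R, ?_⟩
  -- The residue field is viewed as a single block of 1 × 1 matrices, so that `r = m = 1` and there
  -- is one simple class.
  let e : (R ⧸ Ring.jacobson R) ≃+* (PUnit.{1} → Matrix (Fin 1) (Fin 1) (ResidueField R)) :=
    { toFun := fun a _ => Matrix.of fun _ _ => E a
      invFun := fun a => E.symm (a PUnit.unit 0 0)
      left_inv := fun a => E.symm_apply_apply a
      right_inv := fun a => by
        ext i j k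
        rw [Subsingleton.elim j 0, Subsingleton.elim k 0]
        exact E.apply_symm_apply _
      map_mul' := fun a b => by
        ext i j k
        simp [Matrix.mul_apply]
      map_add' := fun a b => by
        ext i j k
        simp }
  let G : (R ⧸ (Ring.jacobson R • ⊤ : Submodule R R)) ≃ₗ[R] R ⧸ Ring.jacobson R :=
    Submodule.quotEquivOfEq _ _ (by rw [smul_eq_mul, Ideal.mul_top])
  let f : (R ⧸ (Ring.jacobson R • ⊤ : Submodule R R)) ≃+
      (PUnit.{1} → Fin 1 → Fin 1 → ResidueField R) :=
    { toFun := fun a _ _ _ => E (G a)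
      invFun := fun a => G.symm (E.symm (a PUnit.unit 0 0))
      left_inv := fun a => by simp
      right_inv := fun a => by
        ext i j k
        rw [Subsingleton.elim j 0, Subsingleton.elim k 0]
        simp
      map_add' := fun a b => by
        ext i j k
        simp }
  have hf : ∀ (a : R) (z : R ⧸ (Ring.jacobson R • ⊤ : Submodule R R)) (i : PUnit) (k : Fin 1),
      f (a • z) i k = (e (Ideal.Quotient.mk (Ring.jacobson R) a) i).mulVec (f z i k) := by
    intro a z i k
    ext l
    change E (G (a • z)) = ∑ _ : Fin 1, E (Ideal.Quotient.mk (Ring.jacobson R) a) * E (G z)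
    rw [Fin.sum_univ_one, ← map_mul, map_smul, Algebra.smul_def]
    rfl
  have key := _root_.hasFormalProd_solomonZeta (M := R) hJfg
    (Ideal.isInvertible_span_singleton hy0)
    (by rw [hJ, hm]; exact Ideal.span_mono (by simp))
    (fun X Y hX hY => by
      obtain ⟨g⟩ := nonempty_linearEquiv_of_isFiniteLength hdim hm X hX
      obtain ⟨h⟩ := nonempty_linearEquiv_of_isFiniteLength hdim hm Y hY
      exact ⟨g.symm.trans h⟩)
    (fun _ => one_pos) e f hf (fun _ => hq) (fun _ => rfl) (fun _ => rfl)
  rw [WedderburnModule.card_simpleModuleClass e fun _ => one_pos] at key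
  simpa using key

end RegularLocalRing

theorem mainTheorem3 :
    (∀ (R : Type u) [Ring R] (M : Type u) [AddCommGroup M] [Module R M]
      -- the standing hypotheses: `R / J` is finite and `J` is finitely generated on the left
      (_ : Finite (R ⧸ Ring.jacobson R)) (_ : (Ring.jacobson R).FG)
      (_ : Module.Finite R M) (_ : Module.Projective R M)
      -- an invertible ideal `I ⊆ J` such that
      -- the finite colength submodules of `M / IM` are all isomorphic
      (I : Ideal R) [I.IsTwoSided] (_ : I.IsInvertible) (_ : I ≤ Ring.jacobson R)
      (_ : ∀ X Y : Submodule R (M ⧸ (I • ⊤ : Submodule R M)),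
        IsFiniteLength R ((M ⧸ (I • ⊤ : Submodule R M)) ⧸ X) →
        IsFiniteLength R ((M ⧸ (I • ⊤ : Submodule R M)) ⧸ Y) → Nonempty (X ≃ₗ[R] Y))
      -- Artin-Wedderburn decompositions of `R / J` and of `M / JM`
      (ι : Type v) [Fintype ι] (F : ι → Type w) [∀ i, Field (F i)] (r' m' : ι → ℕ)
      (_ : ∀ i, 0 < r' i)
      (e : (R ⧸ Ring.jacobson R) ≃+* ((i : ι) → Matrix (Fin (r' i)) (Fin (r' i)) (F i)))
      (f : (M ⧸ (Ring.jacobson R • ⊤ : Submodule R M)) ≃+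
        ((i : ι) → Fin (m' i) → Fin (r' i) → F i))
      (_ : ∀ (a : R) (x : M ⧸ (Ring.jacobson R • ⊤ : Submodule R M)) (i : ι) (k : Fin (m' i)),
        f (a • x) i k = (e (Ideal.Quotient.mk (Ring.jacobson R) a) i).mulVec (f x i k))
      -- homogeneity
      (q r m : ℕ) (_ : ∀ i, Nat.card (F i) = q) (_ : ∀ i, r' i = r) (_ : ∀ i, m' i = m),
      FinitelyManyOfIndex R M ∧
      HasFormalProd
        (fun n => ∏ j ∈ Finset.range m,
          Ring.inverse (1 - dirichletMonomial ((q : ℂ) ^ (j + m * n)) (q ^ (r * (n + 1)))) ^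
            Nat.card (SimpleModuleClass R))
        (solomonZeta R M)) ∧
    -- two-dimensional regular local rings
    (∀ (R : Type u) [CommRing R] [IsRegularLocalRing R] (_ : ringKrullDim R = 2)
      (_ : Finite (IsLocalRing.ResidueField R)) (q : ℕ)
      (_ : Nat.card (IsLocalRing.ResidueField R) = q),
      FinitelyManyOfIndex R R ∧
      HasFormalProd
        (fun n => Ring.inverse (1 - dirichletMonomial ((q : ℂ) ^ n) (q ^ (n + 1))))
        (solomonZeta R R)) := by
  refine ⟨?_, ?_⟩
  · intro R _ M _ _ hR hJ hfin hproj I _ hI hIJ hiso ι _ F _ r' m' hr' e f hf q r m hq hr hm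
    exact ⟨fun n hn => finite_setOf_card_quotient_eq hJ hn M,
      hasFormalProd_solomonZeta hJ hI hIJ hiso hr' e f hf hq hr hm⟩
  · intro R _ _ hdim hR q hq
    exact IsRegularLocalRing.hasFormalProd_solomonZeta hdim hq
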